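/- Consider a weakly coupled Markov decision process with $N$ subproblems and $L$ linking constraints. The sets $\mathcal X_i$, $\mathcal A_i$ ($1\le i\le N$) and $\mathcal W$ are finite, $\mathcal A_i\neq\emptyset$; a state is $s=(x,w)$ with $x=(x_1,\dots,x_N)\in\prod_i\mathcal X_i$ and $w\in\mathcal W$, an action is $a=(a_1,\dots,a_N)\in\mathcal A=\prod_i\mathcal A_i$, and $s_i=(x_i,w)\in\mathcal S_i=\mathcal X_i\times\mathcal W$. From $(s,a)$ the next state is $s'=(x',w')$ with probability $\prod_{i}p_i(x_i'\mid x_i,a_i)\,q(w'\mid w)$; the reward is $r(s,a)=\sum_i r_i(s_i,a_i)$, and the discount factor is $\gamma\in[0,1)$. The feasible actions are $\mathcal A(s)=\{a\in\mathcal A:\sum_i d_i(s_i,a_i)\le b(w)\}$, where $d_i(s_i,a_i),b(w)\in\mathbb R^L$, and every $\mathcal A(s)$ is nonempty. Let $Q^*(s,a)=\max_\pi Q^\pi(s,a)$, where $\pi$ ranges over the maps $s\mapsto\pi(s)\in\mathcal A(s)$ and $Q^\pi(s,a)=\mathbb E[\sum_{t\ge0}\gamma^t r(s_t,a_t)]$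 for the chain with $s_0=s$, $a_0=a$ and $a_t=\pi(s_t)$ for $t\ge1$. For $\lambda\in\mathbb R^L$ let $Q_i^\lambda$ be the unique solution of $$Q_i^\lambda(s_i,a_i)=r_i(s_i,a_i)-\lambda^{\top}d_i(s_i,a_i)+\gamma\,\mathbb E\Bigl[\max_{a_i'\in\mathcal A_i}Q_i^\lambda(s_i',a_i')\Bigr],$$ where $s_i'=(x_i',w')$ with $x_i'\sim p_i(\cdot\mid x_i,a_i)$ and $w'\sim q(\cdot\mid w)$ independent. Let $\Lambda\subset\mathbb R^L_{\ge0}$ be finite and nonempty. Weakly coupled Q-learning (WCQL) uses, at iteration $n=0,1,2,\dots$, an experience $(s_n,a_n,s_n')$: $s_n$, $a_n$ and the step sizes of iteration $n$ are determined by the history $\mathcal F_n$ of the algorithm (with $s_{n+1}=s_n'$ in the case of a single trajectory), and, conditionally on $\mathcal F_n$, $s_n'$ has the transition law from $(s_n,a_n)$. The values $d_i(s_i,\cdot)$, and $b(w)$, of visited states are observed without error, so that the feasible set of a visited state is known. From arbitrary initial tables $B_0$, $Q^\lambda_{i,0}$, $Q'_0$, and writing $s_n'=((x'_{i})_i,w')$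 and $s'_{i}=(x'_{i},w')$, WCQL computes, for all arguments, $$B_{n+1}(w)=B_n(w)+\eta_n(w)\bigl[b(w)+\gamma B_n(w')-B_n(w)\bigr],$$ $$Q^\lambda_{i,n+1}(s_i,a_i)=Q^\lambda_{i,n}(s_i,a_i)+\beta_n(s_i,a_i)\Bigl[r_i(s_i,a_i)-\lambda^{\top}d_i(s_i,a_i)+\gamma\max_{a_i'\in\mathcal A_i}Q^\lambda_{i,n}(s_i',a_i')-Q^\lambda_{i,n}(s_i,a_i)\Bigr],$$ $$Q^\lambda_{n}(s,a)=\lambda^{\top}B_{n}(w)+\sum_i Q^\lambda_{i,n}(s_i,a_i),$$ $$Q_{n+1}(s,a)=Q'_n(s,a)+\alpha_n(s,a)\Bigl[r(s,a)+\gamma\max_{a'\in\mathcal A(s_n')}Q'_n(s_n',a')-Q'_n(s,a)\Bigr],$$ $$Q'_{n+1}(s,a)=\min\Bigl\{\min_{\lambda\in\Lambda}Q^\lambda_{n+1}(s,a),\;Q_{n+1}(s,a)\Bigr\}.$$ The step sizes are nonnegative and vanish at entries that are not visited at iteration $n$: $\alpha_n(s,a)=0$ unless $(s,a)=(s_n,a_n)$,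 $\beta_n(s_i,a_i)=0$ unless $(s_i,a_i)$ is the $i$-th component of $(s_n,a_n)$, and $\eta_n(w)=0$ unless $w$ is the exogenous part of $s_n$. Assume that with probability one: - $\sum_n\alpha_n(s,a)=\infty$ and $\sum_n\alpha_n(s,a)^2<\infty$ for every $s$ and $a\in\mathcal A(s)$; - the same holds for $\beta_n(s_i,a_i)$, for every $i$ and $(s_i,a_i)\in\mathcal S_i\times\mathcal A_i$, and for $\eta_n(w)$, for every $w\in\mathcal W$; - every pair $(s,a)$ with $a\in\mathcal A(s)$ is visited infinitely often. Then with probability one: (i) for every $i$ and $\lambda\in\Lambda$, $\lim_{n\to\infty}Q^\lambda_{i,n}(s_i,a_i)=Q^\lambda_i(s_i,a_i)$ for all $(s_i,a_i)\in\mathcal S_i\times\mathcal A_i$; (ii) for every $\lambda\in\Lambda$, the limit $\lim_{n\to\infty}Q^\lambda_n(s,a)$ exists for all $(s,a)$, and it is at least $Q^*(s,a)$ whenever $a\in\mathcal A(s)$; (iii) $\lim_{n\to\infty}Q'_n(s,a)=Q^*(s,a)$ for every $s$ and $a\in\mathcal A(s)$. -/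

import Mathlib

open MeasureTheory ProbabilityTheory Filter Topology Finset

noncomputable section

namespace WeaklyCoupled

/-- A full state `s = (x, w)`: endogenous components `x i`, one per subproblem, and a shared
exogenous component `w`. -/
@[ext]
structure State {N : ℕ} (X : Fin N → Type*) (W : Type*) where
  x : ∀ i, X i
  w : W

namespace State

variable {N : ℕ} {X : Fin N → Type*} {W : Type*}

/-- A full state is a pair. -/
def equivProd : State X W ≃ (∀ i, X i) × W where
  toFun s := (s.x, s.w)
  invFun p := ⟨p.1, p.2⟩
  left_inv _ := rfl
  right_inv _ := rfl

instance [∀ i, Fintype (X i)] [Fintype W] : Fintype (State X W) :=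
  Fintype.ofEquiv ((∀ i, X i) × W) equivProd.symm

/-- State spaces are discrete. -/
instance : MeasurableSpace (State X W) := ⊤

instance : DiscreteMeasurableSpace (State X W) := ⟨fun _ => trivial⟩

/-- The state `s_i = (x_i, w)` of subproblem `i`. -/
def sub (s : State X W) (i : Fin N) : X i × W := (s.x i, s.w)

end State

/-- A weakly coupled Markov decision process with `N` subproblems and `L` linking constraints
(finite state and action spaces). Rewards and constraint left-hand sides of subproblem `i` are
functions of `s_i = (x_i, w)` and `a_i`. -/
structure WCMDP (N L : ℕ) (X A : Fin N → Type*) (W : Type*)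
    [∀ i, Fintype (X i)] [∀ i, Fintype (A i)] [Fintype W] where
  /-- `p i x a x'` is the probability that subproblem `i` moves from `x` to `x'` under `a`. -/
  p : ∀ i, X i → A i → X i → ℝ
  p_nonneg : ∀ i x a x', 0 ≤ p i x a x'
  p_sum : ∀ i x a, ∑ x', p i x a x' = 1
  /-- `q w w'` is the transition probability of the exogenous state. -/
  q : W → W → ℝ
  q_nonneg : ∀ w w', 0 ≤ q w w'
  q_sum : ∀ w, ∑ w', q w w' = 1
  /-- Subproblem rewards. -/
  r : ∀ i, X i × W → A i → ℝ
  /-- Left-hand sides of the linking constraints. -/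
  d : ∀ i, X i × W → A i → Fin L → ℝ
  /-- Right-hand sides of the linking constraints. -/
  b : W → Fin L → ℝ
  /-- Discount factor. -/
  γ : ℝ
  γ_nonneg : 0 ≤ γ
  γ_lt_one : γ < 1
  /-- Every state has a feasible action. -/
  exists_feasible : ∀ s : State X W, ∃ a : ∀ i, A i, ∑ i, d i (s.sub i) (a i) ≤ b s.w

namespace WCMDP

variable {N L : ℕ} {X A : Fin N → Type*} {W : Type*}
  [∀ i, Fintype (X i)] [∀ i, Fintype (A i)] [Fintype W]
variable (M : WCMDP N L X A W)

open Classical in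
/-- The set of feasible actions in state `s`. -/
def feasible (s : State X W) : Finset (∀ i, A i) :=
  univ.filter fun a => ∑ i, M.d i (s.sub i) (a i) ≤ M.b s.w

theorem feasible_nonempty (s : State X W) : (M.feasible s).Nonempty := by
  obtain ⟨a, ha⟩ := M.exists_feasible s
  exact ⟨a, by simpa [feasible] using ha⟩

/-- The additive reward of the full system. -/
def reward (s : State X W) (a : ∀ i, A i) : ℝ := ∑ i, M.r i (s.sub i) (a i)

/-- Transition probabilities of the full system: the subproblems and the exogenous state move
independently. -/
def trans (s : State X W) (a : ∀ i, A i) (s' : State X W) : ℝ :=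
  (∏ i, M.p i (s.x i) (a i) (s'.x i)) * M.q s.w s'.w

theorem trans_nonneg (s : State X W) (a : ∀ i, A i) (s' : State X W) : 0 ≤ M.trans s a s' :=
  mul_nonneg (prod_nonneg fun _ _ => M.p_nonneg _ _ _ _) (M.q_nonneg _ _)

theorem trans_sum (s : State X W) (a : ∀ i, A i) : ∑ s', M.trans s a s' = 1 := by
  rw [← State.equivProd.symm.sum_comp, Fintype.sum_prod_type]
  simp only [trans, State.equivProd, Equiv.coe_fn_symm_mk]
  simp_rw [← mul_sum, M.q_sum, mul_one]
  classical
  rw [← Fintype.piFinset_univ, ← prod_univ_sum]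
  simp [M.p_sum]

/-- The law of the next full state. -/
def nextLaw (s : State X W) (a : ∀ i, A i) : Measure (State X W) :=
  ∑ s', ENNReal.ofReal (M.trans s a s') • Measure.dirac s'

instance (s : State X W) (a : ∀ i, A i) : IsProbabilityMeasure (M.nextLaw s a) := ⟨by
  simp only [nextLaw, Measure.finsetSum_apply, Measure.smul_apply, measure_univ, smul_eq_mul,
    mul_one]
  rw [← ENNReal.ofReal_sum_of_nonneg fun _ _ => M.trans_nonneg _ _ _, M.trans_sum,
    ENNReal.ofReal_one]⟩

/-- Feasible (stationary deterministic) policies. -/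
def Policy : Type _ := {π : State X W → ∀ i, A i // ∀ s, π s ∈ M.feasible s}

/-- The action taken at time `t` in state `s`: first `a₀`, then according to `π`. -/
def act (π : State X W → ∀ i, A i) (a₀ : ∀ i, A i) (t : ℕ) (s : State X W) : ∀ i, A i :=
  if t = 0 then a₀ else π s

/-- One step of the controlled chain at time `t`, given the history up to time `t`. -/
def stepKernel (π : State X W → ∀ i, A i) (a₀ : ∀ i, A i) (t : ℕ) :
    Kernel (∀ _ : Iic t, State X W) (State X W) where
  toFun h := M.nextLaw (h ⟨t, mem_Iic.2 le_rfl⟩) (act π a₀ t (h ⟨t, mem_Iic.2 le_rfl⟩))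
  measurable' :=
    (measurable_of_countable fun s : State X W => M.nextLaw s (act π a₀ t s)).comp
      (measurable_pi_apply _)

instance (π : State X W → ∀ i, A i) (a₀ : ∀ i, A i) (t : ℕ) :
    IsMarkovKernel (M.stepKernel π a₀ t) :=
  ⟨fun _ => inferInstanceAs (IsProbabilityMeasure (M.nextLaw _ _))⟩

/-- The law of the state trajectory `(s₀, s₁, …)` with `s₀ = s`, `a₀ = a` and `a_t = π s_t` for
`t ≥ 1`. -/
def pathLaw (π : State X W → ∀ i, A i) (s : State X W) (a : ∀ i, A i) :
    Measure (ℕ → State X W) :=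
  Kernel.traj (X := fun _ => State X W) (M.stepKernel π a) 0 (fun _ => s)

/-- `Q^π(s, a)`, the expected discounted reward of `π` after taking `a` in `s`. -/
def policyValue (π : State X W → ∀ i, A i) (s : State X W) (a : ∀ i, A i) : ℝ :=
  ∫ ω, ∑' t : ℕ, M.γ ^ t * M.reward (ω t) (act π a t (ω t)) ∂(M.pathLaw π s a)

/-- The optimal action-value function `Q*(s, a)`, the maximum of `Q^π(s, a)` over the (finitely
many) feasible policies. -/
def Qstar (s : State X W) (a : ∀ i, A i) : ℝ :=
  ⨆ π : M.Policy, M.policyValue π.1 s a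

section Subproblems

variable [∀ i, Nonempty (A i)]

/-- The Bellman operator of subproblem `i` with multiplier `lam`. -/
def subBellman (lam : Fin L → ℝ) (i : Fin N) (Q : X i × W → A i → ℝ) : X i × W → A i → ℝ :=
  fun s a => M.r i s a - lam ⬝ᵥ M.d i s a +
    M.γ * ∑ x', ∑ w', M.p i s.1 a x' * M.q s.2 w' * univ.sup' univ_nonempty (Q (x', w'))

theorem subBellman_contracting (lam : Fin L → ℝ) (i : Fin N) :
    ContractingWith ⟨M.γ, M.γ_nonneg⟩ (M.subBellman lam i) := by
  refine ⟨by exact_mod_cast M.γ_lt_one, LipschitzWith.of_dist_le_mul fun Q Q' => ?_⟩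
  have hγ := M.γ_nonneg
  have hsup : ∀ s, univ.sup' univ_nonempty (Q s) - univ.sup' univ_nonempty (Q' s) ≤ dist Q Q' := by
    intro s
    rw [sub_le_iff_le_add]
    refine sup'_le _ _ fun a _ => ?_
    have h1 : Q s a - Q' s a ≤ dist Q Q' := by
      refine (le_abs_self _).trans ?_
      rw [← Real.dist_eq]
      exact (dist_le_pi_dist (Q s) (Q' s) a).trans (dist_le_pi_dist Q Q' s)
    have h2 := le_sup' (Q' s) (mem_univ a)
    linarith
  have hsup' : ∀ s,
      univ.sup' univ_nonempty (Q' s) - univ.sup' univ_nonempty (Q s) ≤ dist Q Q' := by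
    intro s
    rw [sub_le_iff_le_add]
    refine sup'_le _ _ fun a _ => ?_
    have h1 : Q' s a - Q s a ≤ dist Q Q' := by
      refine (le_abs_self _).trans ?_
      rw [← Real.dist_eq, dist_comm]
      exact (dist_le_pi_dist (Q s) (Q' s) a).trans (dist_le_pi_dist Q Q' s)
    have h2 := le_sup' (Q s) (mem_univ a)
    linarith
  change dist _ _ ≤ M.γ * dist Q Q'
  refine (dist_pi_le_iff (by positivity)).2 fun s => (dist_pi_le_iff (by positivity)).2 fun a => ?_
  rw [Real.dist_eq]
  simp only [subBellman]
  rw [add_sub_add_left_eq_sub, ← mul_sub, abs_mul, abs_of_nonneg hγ]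
  refine mul_le_mul_of_nonneg_left ?_ hγ
  rw [← sum_sub_distrib]
  simp_rw [← sum_sub_distrib, ← mul_sub]
  calc _ ≤ ∑ x', ∑ w', M.p i s.1 a x' * M.q s.2 w' * dist Q Q' := by
        refine (abs_sum_le_sum_abs _ _).trans (sum_le_sum fun x' _ => ?_)
        refine (abs_sum_le_sum_abs _ _).trans (sum_le_sum fun w' _ => ?_)
        have h0 := mul_nonneg (M.p_nonneg i s.1 a x') (M.q_nonneg s.2 w')
        rw [abs_mul, abs_of_nonneg h0]
        exact mul_le_mul_of_nonneg_left (abs_le.2 ⟨by linarith [hsup' (x', w')], hsup _⟩) h0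
    _ = dist Q Q' := by
        simp_rw [← sum_mul, ← mul_sum, M.q_sum, mul_one, M.p_sum, one_mul]

/-- The subproblem Lagrangian action-value function `Q_i^lam`, the unique solution of the
Bellman equation `Q = subBellman lam i Q`. -/
def subQ (lam : Fin L → ℝ) (i : Fin N) : X i × W → A i → ℝ :=
  ContractingWith.fixedPoint (M.subBellman lam i) (M.subBellman_contracting lam i)

theorem subQ_eq (lam : Fin L → ℝ) (i : Fin N) : M.subBellman lam i (M.subQ lam i) = M.subQ lam i :=
  (M.subBellman_contracting lam i).fixedPoint_isFixedPt

theorem subQ_unique {lam : Fin L → ℝ} {i : Fin N} {Q : X i × W → A i → ℝ}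
    (h : M.subBellman lam i Q = Q) : Q = M.subQ lam i :=
  (M.subBellman_contracting lam i).fixedPoint_unique h

end Subproblems

/-- The random inputs of a run of weakly coupled Q-learning. At iteration `n` the tables are updated
with the experience `(state n, action n, next n)`. A trajectory of the process is the
case `state (n + 1) = next n`. -/
structure Run (M : WCMDP N L X A W) (Ω : Type*) where
  /-- The state `s_n` of the experience used at iteration `n`. -/
  state : ℕ → Ω → State X W
  /-- The action `a_n` taken in `s_n` by the behavioral policy. -/
  action : ℕ → Ω → ∀ i, A i
  /-- The successor state `s_n'`. -/
  next : ℕ → Ω → State X W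
  /-- Step sizes `α_n(s, a)` of the main agent. -/
  α : ℕ → Ω → State X W → (∀ i, A i) → ℝ
  /-- Step sizes `β_n(s_i, a_i)` of the subagents. -/
  β : ℕ → Ω → ∀ i, X i × W → A i → ℝ
  /-- Step sizes `η_n(w)` of the right-hand-side estimate. -/
  η : ℕ → Ω → W → ℝ
  /-- Initial table of the main agent. -/
  initQ : Ω → State X W → (∀ i, A i) → ℝ
  /-- Initial tables of the subagents. -/
  initSub : (Fin L → ℝ) → Ω → ∀ i, X i × W → A i → ℝ
  /-- Initial right-hand-side estimate. -/
  initB : Ω → W → Fin L → ℝ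

namespace Run

variable {M} {Ω : Type*} (R : Run M Ω)

/-- The right-hand-side estimate `B_n`. -/
def B (ω : Ω) : ℕ → W → Fin L → ℝ
  | 0 => R.initB ω
  | n + 1 => fun w =>
      B ω n w + R.η n ω w • (M.b w + M.γ • B ω n (R.next n ω).w - B ω n w)

section Iterates

variable [∀ i, Nonempty (A i)]

/-- The subagent iterates `Q_{i,n}^lam`. -/
def sub (lam : Fin L → ℝ) (ω : Ω) : ℕ → ∀ i, X i × W → A i → ℝ
  | 0 => R.initSub lam ω
  | n + 1 => fun i s a =>
      sub lam ω n i s a + R.β n ω i s a *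
        (M.r i s a - lam ⬝ᵥ M.d i s a
          + M.γ * univ.sup' univ_nonempty (sub lam ω n i ((R.next n ω).sub i))
          - sub lam ω n i s a)

/-- The combined estimate `Q_n^lam`. -/
def lag (lam : Fin L → ℝ) (ω : Ω) (n : ℕ) (s : State X W) (a : ∀ i, A i) : ℝ :=
  lam ⬝ᵥ R.B ω n s.w + ∑ i, R.sub lam ω n i (s.sub i) (a i)

/-- The upper bound estimate: the minimum of `Q_n^lam` over the multiplier set. -/
def lagMin (Lam : Finset (Fin L → ℝ)) (hLam : Lam.Nonempty) (ω : Ω) (n : ℕ)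
    (s : State X W) (a : ∀ i, A i) : ℝ :=
  Lam.inf' hLam fun lam => R.lag lam ω n s a

/-- The projected iterates `Q'_n` of weakly coupled Q-learning: a Q-learning step followed by the
projection onto the current upper bound. -/
def wcql (Lam : Finset (Fin L → ℝ)) (hLam : Lam.Nonempty) (ω : Ω) :
    ℕ → State X W → (∀ i, A i) → ℝ
  | 0 => R.initQ ω
  | n + 1 => fun s a =>
      min (R.lagMin Lam hLam ω (n + 1) s a)
        (wcql Lam hLam ω n s a + R.α n ω s a *
          (M.reward s a
            + M.γ * (M.feasible (R.next n ω)).sup' (M.feasible_nonempty _)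
                (wcql Lam hLam ω n (R.next n ω))
            - wcql Lam hLam ω n s a))

end Iterates

/-- The experience is generated by the decision process: `ℱ n` is the history up to the moment when
the state, the action and the step sizes of iteration `n` have been selected, and given this
history the next state has the transition law of the process. The behavioral policy is otherwise
arbitrary. -/
structure IsSampled [mΩ : MeasurableSpace Ω] (R : Run M Ω) (μ : Measure Ω)
    (ℱ : Filtration ℕ mΩ) : Prop where
  state_action : ∀ n s a, MeasurableSet[ℱ n] {ω | R.state n ω = s ∧ R.action n ω = a}
  next : ∀ n s', MeasurableSet[ℱ (n + 1)] {ω | R.next n ω = s'}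
  α : ∀ n s a, Measurable[ℱ n] fun ω => R.α n ω s a
  β : ∀ n i s a, Measurable[ℱ n] fun ω => R.β n ω i s a
  η : ∀ n w, Measurable[ℱ n] fun ω => R.η n ω w
  initQ : ∀ s a, Measurable[ℱ 0] fun ω => R.initQ ω s a
  initSub : ∀ lam i s a, Measurable[ℱ 0] fun ω => R.initSub lam ω i s a
  initB : ∀ w l, Measurable[ℱ 0] fun ω => R.initB ω w l
  next_law : ∀ n s',
    μ[{ω | R.next n ω = s'}.indicator (fun _ => (1 : ℝ)) | ℱ n]
      =ᵐ[μ] fun ω => M.trans (R.state n ω) (R.action n ω) s'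

/-- `∑ u_n = ∞` and `∑ u_n² < ∞` (for nonnegative `u`). -/
def RobbinsMonro (u : ℕ → ℝ) : Prop :=
  Tendsto (fun n => ∑ k ∈ range n, u k) atTop atTop ∧ Summable fun n => u n ^ 2

/-- The step-size assumption. Updates are asynchronous: the step size of an entry is zero at the
iterations at which that entry is not visited, so that the Robbins--Monro sums run over the visits.
For the main agent only the feasible pairs matter. -/
structure StepSizes [MeasurableSpace Ω] (R : Run M Ω) (μ : Measure Ω) : Prop where
  α_nonneg : ∀ n ω s a, 0 ≤ R.α n ω s a
  β_nonneg : ∀ n ω i s a, 0 ≤ R.β n ω i s a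
  η_nonneg : ∀ n ω w, 0 ≤ R.η n ω w
  α_async : ∀ n ω s a, ¬ (R.state n ω = s ∧ R.action n ω = a) → R.α n ω s a = 0
  β_async : ∀ n ω i s a, ¬ ((R.state n ω).sub i = s ∧ R.action n ω i = a) → R.β n ω i s a = 0
  η_async : ∀ n ω w, (R.state n ω).w ≠ w → R.η n ω w = 0
  α_sum : ∀ᵐ ω ∂μ, ∀ s, ∀ a ∈ M.feasible s, RobbinsMonro fun n => R.α n ω s a
  β_sum : ∀ᵐ ω ∂μ, ∀ i s a, RobbinsMonro fun n => R.β n ω i s a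
  η_sum : ∀ᵐ ω ∂μ, ∀ w, RobbinsMonro fun n => R.η n ω w

/-- With probability one, every state and feasible action is visited infinitely often. -/
def VisitsAll [MeasurableSpace Ω] (R : Run M Ω) (μ : Measure Ω) : Prop :=
  ∀ᵐ ω ∂μ, ∀ s, ∀ a ∈ M.feasible s, ∃ᶠ n in atTop, R.state n ω = s ∧ R.action n ω = a

end Run

end WCMDP

end WeaklyCoupled

end

noncomputable section

namespace WeaklyCoupled

/-! ### Averaging recursions -/

/-! The tables `B`, `sub` and `wcql` all follow one scheme: an entry `e` moves by a step `a n e`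
towards the noisy target `g e + γ * V (x n) (ν n)`, whose conditional mean `g e + γ * E (x n) e` is
a sup-norm contraction with fixed point `xs`, and the result may be cut down to an upper bound `u`.
Cutting is harmless as soon as `u` is eventually above `xs - δ` for every `δ > 0`: it preserves
estimates from above, and an entry that was cut is already at least `xs - δ`. Both effects are
recorded by the two inequalities `hupper` and `hlower`.

For a fixed sample path, `tendsto_of_projected_iteration` shows that boundedness is automatic and
that the error bound shrinks by the factor `(1 + γ) / 2` again and again, provided the weighted
noise series converge. Their almost sure convergence is a martingale fact,
`ae_exists_tendsto_sum_mul_sub_condExp`. Together they give `IsSampled.ae_tendsto`.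

For `B` and `sub` nothing is cut, so `u` can be the limit itself. For `wcql` the bound is `lagMin`,
and what is needed is weak Lagrangian duality, `Qstar_le_lagrangian`: for `lam ≥ 0` the limit of
`lag` is a supersolution of the Bellman optimality equation on feasible pairs. Indeed, the
multiplier times the constraint slack is nonnegative, and dropping the constraints from the next
maximum only increases it and makes it split over subproblems. -/

/-- By `1 - a ≤ exp (-a)`, the product of the contraction factors is at most the exponential of
minus a divergent sum. -/
theorem tendsto_zero_of_le_one_sub_mul {a p : ℕ → ℝ}
    (hsum : Tendsto (fun n => ∑ k ∈ range n, a k) atTop atTop) (hp : ∀ n, 0 ≤ p n)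
    (h : ∀ᶠ n in atTop, p (n + 1) ≤ (1 - a n) * p n) : Tendsto p atTop (𝓝 0) := by
  obtain ⟨m, hm⟩ := eventually_atTop.1 h
  have key : ∀ n, m ≤ n →
      p n ≤ p m * Real.exp (∑ k ∈ range m, a k - ∑ k ∈ range n, a k) := by
    intro n hn
    induction n, hn using Nat.le_induction with
    | base => simp
    | succ n hn ih =>
      have h1 : 1 - a n ≤ Real.exp (-a n) := by linarith [Real.add_one_le_exp (-a n)]
      calc p (n + 1) ≤ (1 - a n) * p n := hm n hn
        _ ≤ Real.exp (-a n) * p n := mul_le_mul_of_nonneg_right h1 (hp n)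
        _ ≤ Real.exp (-a n) *
            (p m * Real.exp (∑ k ∈ range m, a k - ∑ k ∈ range n, a k)) :=
          mul_le_mul_of_nonneg_left ih (Real.exp_pos _).le
        _ = p m * Real.exp (∑ k ∈ range m, a k - ∑ k ∈ range (n + 1), a k) := by
          rw [mul_left_comm, ← Real.exp_add, sum_range_succ]
          congr 2
          ring
  have hlim : Tendsto
      (fun n => p m * Real.exp (∑ k ∈ range m, a k - ∑ k ∈ range n, a k)) atTop (𝓝 0) := by
    have h2 : Tendsto (fun n => ∑ k ∈ range m, a k - ∑ k ∈ range n, a k) atTop atBot :=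
      tendsto_atBot_add_const_left _ _ (tendsto_neg_atTop_atBot.comp hsum)
    simpa using (Real.tendsto_exp_atBot.comp h2).const_mul (p m)
  exact tendsto_of_tendsto_of_tendsto_of_le_of_le' tendsto_const_nhds hlim
    (Eventually.of_forall hp) (eventually_atTop.2 ⟨m, key⟩)

/-- The positive part of `z - c` shrinks by `1 - a n` at each step. The outer `max` leaves room for
steps at which the projection resets the iterate to a level below `c`. -/
theorem eventually_lt_of_le_max_average {a z : ℕ → ℝ} {c δ : ℝ} (hδ : 0 < δ)
    (ha1 : ∀ᶠ n in atTop, a n ≤ 1)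
    (hsum : Tendsto (fun n => ∑ k ∈ range n, a k) atTop atTop)
    (h : ∀ᶠ n in atTop, z (n + 1) ≤ max c ((1 - a n) * z n + a n * c)) :
    ∀ᶠ n in atTop, z n < c + δ := by
  have hp : Tendsto (fun n => max (z n - c) 0) atTop (𝓝 0) := by
    refine tendsto_zero_of_le_one_sub_mul hsum (fun n => le_max_right _ _) ?_
    filter_upwards [ha1, h] with n hn hz
    have h0 : 0 ≤ (1 - a n) * max (z n - c) 0 :=
      mul_nonneg (by linarith) (le_max_right _ _)
    have h1 : (1 - a n) * (z n - c) ≤ (1 - a n) * max (z n - c) 0 :=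
      mul_le_mul_of_nonneg_left (le_max_left _ _) (by linarith)
    refine max_le ?_ h0
    rcases le_max_iff.1 hz with h2 | h2 <;> linarith
  filter_upwards [hp.eventually_lt_const hδ] with n hn
  linarith [le_max_left (z n - c) 0]

/-- Summation by parts: with `S` the partial sums of the noise, `W + (l - S)` is averaged with
weight `a n` towards `l - S n`, which tends to zero. -/
theorem tendsto_zero_of_noise {a ξ W : ℕ → ℝ} {l : ℝ} (ha0 : ∀ n, 0 ≤ a n)
    (ha1 : ∀ᶠ n in atTop, a n ≤ 1)
    (hsum : Tendsto (fun n => ∑ k ∈ range n, a k) atTop atTop)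
    (hξ : Tendsto (fun n => ∑ k ∈ range n, a k * ξ k) atTop (𝓝 l))
    (hW : ∀ n, W (n + 1) = (1 - a n) * W n + a n * ξ n) : Tendsto W atTop (𝓝 0) := by
  set S : ℕ → ℝ := fun n => ∑ k ∈ range n, a k * ξ k with hS
  have hS1 : ∀ n, S (n + 1) = S n + a n * ξ n := fun n => sum_range_succ _ _
  rw [Metric.tendsto_atTop'] at hξ
  rw [Metric.tendsto_nhds]
  intro ε hε
  obtain ⟨m, hm⟩ := hξ (ε / 4) (by linarith)
  have hR : ∀ᶠ n in atTop, |S n - l| < ε / 4 := by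
    filter_upwards [eventually_gt_atTop m] with n hn
    exact hm n hn
  have h1 := eventually_lt_of_le_max_average (a := a) (z := fun n => W n + (l - S n)) (c := ε / 4)
    (δ := ε / 4) (by linarith) ha1 hsum (by
      filter_upwards [hR] with n hn
      refine le_max_of_le_right ?_
      rw [hW, hS1]
      have := mul_le_mul_of_nonneg_left (show l - S n ≤ ε / 4 by linarith [(abs_lt.1 hn).1]) (ha0 n)
      linarith)
  have h2 := eventually_lt_of_le_max_average (a := a) (z := fun n => -(W n + (l - S n)))
    (c := ε / 4) (δ := ε / 4) (by linarith) ha1 hsum (by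
      filter_upwards [hR] with n hn
      refine le_max_of_le_right ?_
      rw [hW, hS1]
      have := mul_le_mul_of_nonneg_left (show S n - l ≤ ε / 4 by linarith [(abs_lt.1 hn).2]) (ha0 n)
      linarith)
  filter_upwards [h1, h2, hR] with n h1 h2 h3
  rw [Real.dist_eq, sub_zero, abs_lt]
  rw [abs_lt] at h3
  constructor <;> linarith

/-! ### Asynchronous stochastic approximation with a projection onto an upper bound -/

/-- `F` is nonexpansive in the sup norm. -/
def Nonexpansive {ι κ : Type*} (F : (ι → ℝ) → κ → ℝ) : Prop :=
  ∀ x y c, 0 ≤ c → (∀ e, |x e - y e| ≤ c) → ∀ s, |F x s - F y s| ≤ c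

section Deterministic

variable {ι S : Type*} [Finite ι] {γ : ℝ} {g xs : ι → ℝ} {V : (ι → ℝ) → S → ℝ}
  {ν : ℕ → S} {a x u : ℕ → ι → ℝ}

/-- The noise enters only through `ν n` in a finite set, so the noisy targets at `xs` are uniformly
bounded and a large ball around `xs` is invariant on every path, with no probabilistic input. -/
theorem exists_abs_le_of_projected_iteration [Finite S] (hγ0 : 0 ≤ γ) (hγ1 : γ < 1) (hV : Nonexpansive V)
    (ha0 : ∀ n e, 0 ≤ a n e) (ha1 : ∀ e, ∀ᶠ n in atTop, a n e ≤ 1)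
    (hupper : ∀ n e, x (n + 1) e ≤ x n e + a n e * (g e + γ * V (x n) (ν n) - x n e))
    (hlower : ∀ n e, min (u (n + 1) e) (x n e + a n e * (g e + γ * V (x n) (ν n) - x n e))
      ≤ x (n + 1) e)
    (hu : ∀ e, ∀ δ > 0, ∀ᶠ n in atTop, xs e - δ ≤ u n e) :
    ∃ K, ∀ᶠ n in atTop, ∀ e, |x n e - xs e| ≤ K := by
  obtain ⟨C, hC⟩ : ∃ C, ∀ e s, |g e + γ * V xs s - xs e| ≤ C := by
    obtain ⟨C, hC⟩ := Set.Finite.bddAbove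
      (Set.finite_range fun p : ι × S => |g p.1 + γ * V xs p.2 - xs p.1|)
    exact ⟨C, fun e s => hC ⟨(e, s), rfl⟩⟩
  obtain ⟨m, hm⟩ := eventually_atTop.1
    ((eventually_all.2 ha1).and (eventually_all.2 fun e => hu e 1 one_pos))
  obtain ⟨K₀, hK₀⟩ : ∃ K, ∀ e, |x m e - xs e| ≤ K := by
    obtain ⟨C, hC⟩ := Set.Finite.bddAbove (Set.finite_range fun e => |x m e - xs e|)
    exact ⟨C, fun e => hC ⟨e, rfl⟩⟩
  have hg : 0 < 1 - γ := by linarith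
  -- `K₀` covers time `m`, `1` covers a cut at `u ≥ xs - 1`, and the last condition gives `γ * K + C
  -- ≤ K`, which keeps noisy targets in the ball.
  obtain ⟨K, hK0, hK1, hKC⟩ : ∃ K, K₀ ≤ K ∧ 1 ≤ K ∧ C ≤ (1 - γ) * K :=
    ⟨max K₀ (max 1 (C / (1 - γ))), le_max_left _ _, (le_max_left _ _).trans (le_max_right _ _), by
      rw [← div_le_iff₀' hg]
      exact (le_max_right _ _).trans (le_max_right _ _)⟩
  refine ⟨K, eventually_atTop.2 ⟨m, fun n hn => ?_⟩⟩
  induction n, hn using Nat.le_induction with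
  | base => exact fun e => (hK₀ e).trans hK0
  | succ n hn ih =>
    intro e
    have h1 := (hm n hn).1 e
    have h2 := (hm (n + 1) (by omega)).2 e
    have h3 := abs_le.1 (hV (x n) xs K (by linarith) ih (ν n))
    have h4 := abs_le.1 (hC e (ν n))
    have h5 := abs_le.1 (ih e)
    have h0 := ha0 n e
    have hup := hupper n e
    have hlo := hlower n e
    have h6 : g e + γ * V (x n) (ν n) - xs e ≤ K := by
      nlinarith [mul_le_mul_of_nonneg_left h3.2 hγ0]
    have h7 : -K ≤ g e + γ * V (x n) (ν n) - xs e := by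
      nlinarith [mul_le_mul_of_nonneg_left h3.1 hγ0]
    have h8 : x n e + a n e * (g e + γ * V (x n) (ν n) - x n e) - xs e
        = (1 - a n e) * (x n e - xs e) + a n e * (g e + γ * V (x n) (ν n) - xs e) := by ring
    have h9 := mul_le_mul_of_nonneg_left h5.1 (show 0 ≤ 1 - a n e by linarith)
    have h10 := mul_le_mul_of_nonneg_left h5.2 (show 0 ≤ 1 - a n e by linarith)
    have h11 := mul_le_mul_of_nonneg_left h6 h0
    have h12 := mul_le_mul_of_nonneg_left h7 h0
    rw [abs_le]
    constructor
    · rcases min_le_iff.1 hlo with h | h <;> linarith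
    · linarith

/-- Once the accumulated noise `W` is subtracted, the error is averaged towards a quantity of size
at most `γ * D`. Since `W` tends to zero, any factor above `γ` is eventually reached; `(1 + γ) / 2`
is one below `1`. -/
theorem eventually_abs_le_mul_of_projected_iteration {E : (ι → ℝ) → ι → ℝ} {D : ℝ}
    (hγ0 : 0 ≤ γ) (hγ1 : γ < 1) (hE : Nonexpansive E) (hxs : ∀ e, xs e = g e + γ * E xs e)
    (ha0 : ∀ n e, 0 ≤ a n e) (ha1 : ∀ e, ∀ᶠ n in atTop, a n e ≤ 1)
    (hsum : ∀ e, Tendsto (fun n => ∑ k ∈ range n, a k e) atTop atTop)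
    (hupper : ∀ n e, x (n + 1) e ≤ x n e + a n e * (g e + γ * V (x n) (ν n) - x n e))
    (hlower : ∀ n e, min (u (n + 1) e) (x n e + a n e * (g e + γ * V (x n) (ν n) - x n e))
      ≤ x (n + 1) e)
    (hu : ∀ e, ∀ δ > 0, ∀ᶠ n in atTop, xs e - δ ≤ u n e)
    (hnoise : ∀ e, ∃ l, Tendsto
      (fun n => ∑ k ∈ range n, a k e * (γ * (V (x k) (ν k) - E (x k) e))) atTop (𝓝 l))
    (hD : 0 < D) (hx : ∀ᶠ n in atTop, ∀ e, |x n e - xs e| ≤ D) :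
    ∀ᶠ n in atTop, ∀ e, |x n e - xs e| ≤ (1 + γ) / 2 * D := by
  refine eventually_all.2 fun e => ?_
  obtain ⟨l, hl⟩ := hnoise e
  set ξ : ℕ → ℝ := fun k => γ * (V (x k) (ν k) - E (x k) e) with hξ
  let W : ℕ → ℝ := fun n => Nat.rec 0 (fun k w => (1 - a k e) * w + a k e * ξ k) n
  have hW : ∀ n, W (n + 1) = (1 - a n e) * W n + a n e * ξ n := fun _ => rfl
  have hW0 : Tendsto W atTop (𝓝 0) :=
    tendsto_zero_of_noise (fun n => ha0 n e) (ha1 e) (hsum e) hl hW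
  set δ := (1 - γ) * D / 8 with hδdef
  have hδ : 0 < δ := by
    have : 0 < (1 - γ) * D := mul_pos (by linarith) hD
    linarith
  have hγD : 0 ≤ γ * D := by positivity
  have hWδ : ∀ᶠ n in atTop, |W n| < δ := by
    filter_upwards [Metric.tendsto_nhds.1 hW0 δ hδ] with n hn
    simpa [Real.dist_eq] using hn
  have hstep : ∀ᶠ n in atTop,
      |g e + γ * E (x n) e - xs e| ≤ γ * D := by
    filter_upwards [hx] with n hn
    have := hE (x n) xs D hD.le hn e
    nth_rw 1 [hxs e]
    rw [show g e + γ * E (x n) e - (g e + γ * E xs e) = γ * (E (x n) e - E xs e) by ring, abs_mul,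
      abs_of_nonneg hγ0]
    exact mul_le_mul_of_nonneg_left this hγ0
  have h1 := eventually_lt_of_le_max_average (a := fun n => a n e)
    (z := fun n => x n e - xs e - W n) (c := γ * D) hδ (ha1 e) (hsum e) (by
      filter_upwards [hstep] with n hn
      refine le_max_of_le_right ?_
      have h3 := mul_le_mul_of_nonneg_left (abs_le.1 hn).2 (ha0 n e)
      have h4 := hupper n e
      rw [hW]
      simp only [hξ]
      linarith)
  have h2 := eventually_lt_of_le_max_average (a := fun n => a n e)
    (z := fun n => -(x n e - xs e - W n)) (c := max (2 * δ) (γ * D)) hδ (ha1 e) (hsum e) (by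
      filter_upwards [hstep, (tendsto_add_atTop_nat 1).eventually hWδ,
        (tendsto_add_atTop_nat 1).eventually (hu e δ hδ)] with n hn hWn hun
      -- If the cut was active, the new entry is at least `xs e - δ`, and `|W (n + 1)| < δ` gives
      -- the level `2 * δ`; otherwise the averaging estimate applies.
      rcases min_le_iff.1 (hlower n e) with h | h
      · refine le_max_of_le_left (le_max_of_le_left ?_)
        linarith [(abs_lt.1 hWn).2]
      · refine le_max_of_le_right ?_
        have h3 := mul_le_mul_of_nonneg_left (abs_le.1 hn).1 (ha0 n e)
        have h4 := mul_le_mul_of_nonneg_left (le_max_right (2 * δ) (γ * D)) (ha0 n e)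
        rw [hW]
        simp only [hξ]
        linarith)
  filter_upwards [h1, h2, hWδ] with n h1 h2 h3
  rw [abs_lt] at h3
  -- One `δ` is the margin of the averaging lemma, the other pays for adding `W` back; `δ = (1 - γ)
  -- * D / 8` suits both branches.
  have h5 : max (2 * δ) (γ * D) + 2 * δ ≤ (1 + γ) / 2 * D := by
    rcases max_cases (2 * δ) (γ * D) with h | h <;> rw [h.1] <;> nlinarith
  have h6 := le_max_right (2 * δ) (γ * D)
  rw [abs_le]
  constructor <;> linarith

theorem tendsto_of_projected_iteration [Finite S] {E : (ι → ℝ) → ι → ℝ}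
    (hγ0 : 0 ≤ γ) (hγ1 : γ < 1) (hV : Nonexpansive V) (hE : Nonexpansive E)
    (hxs : ∀ e, xs e = g e + γ * E xs e)
    (ha0 : ∀ n e, 0 ≤ a n e) (ha1 : ∀ e, ∀ᶠ n in atTop, a n e ≤ 1)
    (hsum : ∀ e, Tendsto (fun n => ∑ k ∈ range n, a k e) atTop atTop)
    (hupper : ∀ n e, x (n + 1) e ≤ x n e + a n e * (g e + γ * V (x n) (ν n) - x n e))
    (hlower : ∀ n e, min (u (n + 1) e) (x n e + a n e * (g e + γ * V (x n) (ν n) - x n e))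
      ≤ x (n + 1) e)
    (hu : ∀ e, ∀ δ > 0, ∀ᶠ n in atTop, xs e - δ ≤ u n e)
    (hnoise : ∀ e, ∃ l, Tendsto
      (fun n => ∑ k ∈ range n, a k e * (γ * (V (x k) (ν k) - E (x k) e))) atTop (𝓝 l)) :
    ∀ e, Tendsto (fun n => x n e) atTop (𝓝 (xs e)) := by
  obtain ⟨K, hK⟩ := exists_abs_le_of_projected_iteration hγ0 hγ1 hV ha0 ha1 hupper hlower hu
  -- `|K| + 1` replaces `K` because the contraction lemma asks for a positive radius.
  have hpow : ∀ k : ℕ, ∀ᶠ n in atTop, ∀ e, |x n e - xs e| ≤ ((1 + γ) / 2) ^ k * (|K| + 1) := by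
    intro k
    induction k with
    | zero =>
      filter_upwards [hK] with n hn e
      linarith [hn e, le_abs_self K]
    | succ k ih =>
      rw [pow_succ', mul_assoc]
      exact eventually_abs_le_mul_of_projected_iteration hγ0 hγ1 hE hxs ha0 ha1 hsum hupper hlower
        hu hnoise (by positivity) ih
  have hlim : Tendsto (fun k : ℕ => ((1 + γ) / 2) ^ k * (|K| + 1)) atTop (𝓝 0) := by
    simpa using (tendsto_pow_atTop_nhds_zero_of_lt_one (r := (1 + γ) / 2) (by linarith)
      (by linarith)).mul_const (|K| + 1)
  intro e
  rw [Metric.tendsto_nhds]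
  intro ε hε
  obtain ⟨k, hk⟩ := (hlim.eventually_lt_const hε).exists
  filter_upwards [hpow k] with n hn
  exact (hn e).trans_lt hk

end Deterministic

/-- Banach's theorem, used for the limit of `B`, for policy evaluation and for the optimality
equation. -/
theorem Nonexpansive.exists_fixedPoint {ι : Type*} [Fintype ι] {E : (ι → ℝ) → ι → ℝ}
    (hE : Nonexpansive E) {γ : ℝ} (hγ0 : 0 ≤ γ) (hγ1 : γ < 1) (g : ι → ℝ) :
    ∃ x : ι → ℝ, ∀ e, x e = g e + γ * E x e := by
  have hc : ContractingWith ⟨γ, hγ0⟩ fun (x : ι → ℝ) e => g e + γ * E x e := by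
    refine ⟨by exact_mod_cast hγ1, LipschitzWith.of_dist_le_mul fun x y => ?_⟩
    change dist _ _ ≤ γ * dist x y
    refine (dist_pi_le_iff (by positivity)).2 fun e => ?_
    rw [Real.dist_eq, add_sub_add_left_eq_sub, ← mul_sub, abs_mul, abs_of_nonneg hγ0]
    exact mul_le_mul_of_nonneg_left
      (hE x y _ dist_nonneg (fun e => by simpa [Real.dist_eq] using dist_le_pi_dist x y e) e) hγ0
  exact ⟨ContractingWith.fixedPoint _ hc, fun e => (congrFun hc.fixedPoint_isFixedPt e).symm⟩

theorem Nonexpansive.measurable {ι κ : Type*} [Fintype ι] {F : (ι → ℝ) → κ → ℝ}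
    (hF : Nonexpansive F) (s : κ) : Measurable fun x => F x s := by
  refine Continuous.measurable (LipschitzWith.continuous (K := 1) ?_)
  refine LipschitzWith.of_dist_le_mul fun x y => ?_
  rw [NNReal.coe_one, one_mul, Real.dist_eq]
  exact hF x y _ dist_nonneg (fun e => by simpa [Real.dist_eq] using dist_le_pi_dist x y e) s

/-! ### Convergence of weighted martingale difference series -/

section Noise

variable {Ω : Type*} {mΩ : MeasurableSpace Ω} {μ : Measure Ω} [IsProbabilityMeasure μ]
  {ℱ : Filtration ℕ mΩ}

/-- Martingale increments are orthogonal, so the partial sums are bounded in `L²`, hence in `L¹`,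
and Doob's convergence theorem applies. -/
theorem ae_exists_tendsto_sum_of_sq_bounded {ξ : ℕ → Ω → ℝ} {b K : ℝ}
    (hmeas : ∀ n, StronglyMeasurable[ℱ (n + 1)] (ξ n))
    (hbdd : ∀ n, ∀ᵐ ω ∂μ, |ξ n ω| ≤ b) (hcond : ∀ n, μ[ξ n | ℱ n] =ᵐ[μ] 0)
    (hK : ∀ n, ∑ k ∈ range n, ∫ ω, ξ k ω ^ 2 ∂μ ≤ K) :
    ∀ᵐ ω ∂μ, ∃ l, Tendsto (fun n => ∑ k ∈ range n, ξ k ω) atTop (𝓝 l) := by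
  set S : ℕ → Ω → ℝ := fun n ω => ∑ k ∈ range n, ξ k ω with hS
  have hSm : ∀ n, StronglyMeasurable[ℱ n] (S n) := fun n =>
    Finset.stronglyMeasurable_fun_sum _ fun k hk =>
      (hmeas k).mono (ℱ.mono (mem_range.1 hk))
  have hSb : ∀ n, ∀ᵐ ω ∂μ, ‖S n ω‖ ≤ n * b := by
    intro n
    filter_upwards [ae_all_iff.2 hbdd] with ω hω
    calc ‖S n ω‖ ≤ ∑ k ∈ range n, |ξ k ω| := abs_sum_le_sum_abs _ _
      _ ≤ ∑ _k ∈ range n, b := sum_le_sum fun k _ => hω k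
      _ = n * b := by simp
  have hξm : ∀ n, AEStronglyMeasurable (ξ n) μ := fun n =>
    ((hmeas n).mono (ℱ.le _)).aestronglyMeasurable
  have hSm' : ∀ n, AEStronglyMeasurable (S n) μ := fun n =>
    ((hSm n).mono (ℱ.le _)).aestronglyMeasurable
  have hξi : ∀ n, Integrable (ξ n) μ := fun n => Integrable.of_bound (hξm n) b (hbdd n)
  have hSi : ∀ n, Integrable (S n) μ := fun n => Integrable.of_bound (hSm' n) _ (hSb n)
  have hSξ : ∀ n, Integrable (S n * ξ n) μ := fun n => (hξi n).bdd_mul (hSm' n) (hSb n)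
  have hSS : ∀ n, Integrable (fun ω => S n ω ^ 2) μ := fun n => by
    simpa only [sq] using (hSi n).bdd_mul (hSm' n) (hSb n)
  have hξξ : ∀ n, Integrable (fun ω => ξ n ω ^ 2) μ := fun n => by
    simpa only [sq] using (hξi n).bdd_mul (hξm n) (hbdd n)
  have hmart : Martingale S ℱ μ := by
    refine martingale_of_condExp_sub_eq_zero_nat hSm hSi fun n => ?_
    have : S (n + 1) - S n = ξ n := by
      ext ω
      simp [hS, sum_range_succ]
    rw [this]
    exact hcond n
  have horth : ∀ n, ∫ ω, (S n * ξ n) ω ∂μ = 0 := by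
    intro n
    rw [← integral_condExp (ℱ.le n)]
    refine integral_eq_zero_of_ae ?_
    filter_upwards [condExp_mul_of_stronglyMeasurable_left (hSm n) (hSξ n) (hξi n), hcond n]
      with ω h1 h2
    rw [h1, Pi.mul_apply, h2]
    simp
  have hsq : ∀ n, ∫ ω, S n ω ^ 2 ∂μ = ∑ k ∈ range n, ∫ ω, ξ k ω ^ 2 ∂μ := by
    intro n
    induction n with
    | zero => simp [hS]
    | succ n ih =>
      have h1 : (fun ω => S (n + 1) ω ^ 2)
          = fun ω => (S n ω ^ 2 + 2 * (S n * ξ n) ω) + ξ n ω ^ 2 := by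
        ext ω
        simp only [hS, sum_range_succ, Pi.mul_apply]
        ring
      have h2 : Integrable (fun ω => S n ω ^ 2 + 2 * (S n * ξ n) ω) μ :=
        (hSS n).add ((hSξ n).const_mul 2)
      rw [h1, integral_add h2 (hξξ n),
        integral_add (hSS n) ((hSξ n).const_mul 2), integral_const_mul, horth, ih, sum_range_succ]
      ring
  refine hmart.submartingale.exists_ae_tendsto_of_bdd (R := (1 + K).toNNReal) fun n => ?_
  rw [eLpNorm_one_eq_lintegral_enorm, ← ofReal_integral_norm_eq_lintegral_enorm (hSi n)]
  refine ENNReal.ofReal_le_ofReal ?_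
  calc ∫ ω, ‖S n ω‖ ∂μ ≤ ∫ ω, (1 + S n ω ^ 2) ∂μ := by
        refine integral_mono (hSi n).norm ((integrable_const _).add (hSS n)) fun ω => ?_
        have : |S n ω| ^ 2 = S n ω ^ 2 := sq_abs _
        simp only [Real.norm_eq_abs]
        nlinarith [sq_nonneg (|S n ω| - 1), abs_nonneg (S n ω)]
    _ ≤ 1 + K := by
        rw [integral_add (integrable_const _) (hSS n), hsq]
        simpa using hK n

/-- The squares of the weights are summable only pathwise, with no integrable bound. Truncating the
weights once their squares exceed a level `K` reduces to the `L²` case, and almost every path is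
untouched by the truncation for some natural `K`. -/
theorem ae_exists_tendsto_sum_mul_sub_condExp {c f : ℕ → Ω → ℝ}
    (hc : ∀ n, Measurable[ℱ n] (c n)) (hf : ∀ n, Measurable[ℱ (n + 1)] (f n))
    (hf1 : ∀ n ω, |f n ω| ≤ 1) (hsum : ∀ᵐ ω ∂μ, Summable fun n => c n ω ^ 2) :
    ∀ᵐ ω ∂μ, ∃ l, Tendsto
      (fun n => ∑ k ∈ range n, c k ω * (f k ω - (μ[f k | ℱ k]) ω)) atTop (𝓝 l) := by
  -- The sum includes the index `n`: `c n` is known at time `n`, so the event stays in `ℱ n`, and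
  -- the truncated weight itself is bounded.
  let T : ℕ → ℕ → Set Ω := fun K n => {ω | ∑ k ∈ range (n + 1), c k ω ^ 2 ≤ K}
  have hT : ∀ K n, MeasurableSet[ℱ n] (T K n) := fun K n =>
    measurableSet_le (Finset.measurable_fun_sum _ fun k hk =>
      ((hc k).mono (ℱ.mono (Nat.lt_succ_iff.1 (mem_range.1 hk))) le_rfl).pow_const 2)
      measurable_const
  let d : ℕ → ℕ → Ω → ℝ := fun K n => (T K n).indicator (c n)
  have hdm : ∀ K n, StronglyMeasurable[ℱ n] (d K n) := fun K n =>
    ((hc n).stronglyMeasurable).indicator (hT K n)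
  have hdsum : ∀ K n ω, ∑ k ∈ range n, d K k ω ^ 2 ≤ K := by
    intro K n ω
    induction n with
    | zero => simp
    | succ n ih =>
      by_cases hω : ω ∈ T K n
      · refine le_trans (sum_le_sum fun k _ => ?_) hω
        by_cases h : ω ∈ T K k
        · simp [d, h]
        · simp [d, h, sq_nonneg]
      · rw [sum_range_succ]
        simpa [d, hω] using ih
  have hdb : ∀ K n ω, |d K n ω| ≤ K + 1 := by
    intro K n ω
    have h1 : d K n ω ^ 2 ≤ K :=
      (single_le_sum (f := fun k => d K k ω ^ 2) (fun _ _ => sq_nonneg _)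
        (mem_range.2 n.lt_succ_self)).trans (hdsum K (n + 1) ω)
    have h2 : (0 : ℝ) ≤ K := Nat.cast_nonneg K
    exact abs_le_of_sq_le_sq (by nlinarith) (by linarith)
  have hfi : ∀ n, Integrable (f n) μ := fun n =>
    Integrable.of_bound (((hf n).mono (ℱ.le _) le_rfl).aestronglyMeasurable) 1
      (Eventually.of_forall (hf1 n))
  let g : ℕ → Ω → ℝ := fun n => f n - μ[f n | ℱ n]
  have hgi : ∀ n, Integrable (g n) μ := fun n => (hfi n).sub integrable_condExp
  have hgm : ∀ n, StronglyMeasurable[ℱ (n + 1)] (g n) := fun n =>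
    (hf n).stronglyMeasurable.sub (stronglyMeasurable_condExp.mono (ℱ.mono n.le_succ))
  have hgb : ∀ n, ∀ᵐ ω ∂μ, |g n ω| ≤ 2 := by
    intro n
    have h := ae_bdd_abs_condExp_of_ae_bdd_abs (m := ℱ n) (R := 1) (f := f n) (μ := μ)
      (Eventually.of_forall (hf1 n))
    filter_upwards [h] with ω hω
    have := (abs_sub (f n ω) ((μ[f n | ℱ n]) ω))
    exact this.trans (by linarith [hf1 n ω])
  have hgc : ∀ n, μ[g n | ℱ n] =ᵐ[μ] 0 := by
    intro n
    have h1 := condExp_sub (hfi n) (integrable_condExp (m := ℱ n) (f := f n)) (ℱ n)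
    rw [condExp_of_stronglyMeasurable (ℱ.le n) stronglyMeasurable_condExp integrable_condExp] at h1
    filter_upwards [h1] with ω h1
    simpa using h1
  have hconv : ∀ K : ℕ, ∀ᵐ ω ∂μ, ∃ l,
      Tendsto (fun n => ∑ k ∈ range n, (d K k * g k) ω) atTop (𝓝 l) := by
    intro K
    refine ae_exists_tendsto_sum_of_sq_bounded (ℱ := ℱ) (b := (K + 1) * 2) (K := K * 4)
      (fun n => ((hdm K n).mono (ℱ.mono n.le_succ)).mul (hgm n)) (fun n => ?_) (fun n => ?_)
      fun n => ?_
    · filter_upwards [hgb n] with ω hω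
      rw [Pi.mul_apply, abs_mul]
      exact mul_le_mul (hdb K n ω) hω (abs_nonneg _) (by positivity)
    · filter_upwards [condExp_mul_of_stronglyMeasurable_left (hdm K n)
        ((hgi n).bdd_mul ((hdm K n).mono (ℱ.le n)).aestronglyMeasurable
          (Eventually.of_forall (hdb K n))) (hgi n), hgc n] with ω h1 h2
      rw [h1, Pi.mul_apply, h2]
      simp
    · have hi : ∀ k, Integrable (fun ω => (d K k * g k) ω ^ 2) μ := by
        intro k
        refine Integrable.of_bound ((((hdm K k).mono (ℱ.le _)).mul
          ((hgm k).mono (ℱ.le _))).pow 2).aestronglyMeasurable (((K + 1) * 2) ^ 2) ?_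
        filter_upwards [hgb k] with ω hω
        rw [Real.norm_eq_abs, abs_pow, Pi.mul_apply, abs_mul]
        exact pow_le_pow_left₀ (by positivity)
          (mul_le_mul (hdb K k ω) hω (abs_nonneg _) (by positivity)) 2
      rw [← integral_finsetSum _ fun k _ => hi k]
      calc _ ≤ ∫ _ω, (K * 4 : ℝ) ∂μ := by
            refine integral_mono_ae (integrable_finsetSum _ fun k _ => hi k) (integrable_const _) ?_
            filter_upwards [ae_all_iff.2 hgb] with ω hω
            calc ∑ k ∈ range n, (d K k * g k) ω ^ 2 ≤ ∑ k ∈ range n, d K k ω ^ 2 * 4 := by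
                  refine sum_le_sum fun k _ => ?_
                  rw [Pi.mul_apply, mul_pow]
                  have : g k ω ^ 2 ≤ 2 ^ 2 := sq_le_sq' (abs_le.1 (hω k)).1 (abs_le.1 (hω k)).2
                  exact mul_le_mul_of_nonneg_left (by linarith) (sq_nonneg _)
              _ ≤ K * 4 := by
                  rw [← sum_mul]
                  exact mul_le_mul_of_nonneg_right (hdsum K n ω) (by norm_num)
        _ = K * 4 := by simp
  filter_upwards [ae_all_iff.2 hconv, hsum] with ω h1 h2
  obtain ⟨K, hK⟩ := exists_nat_ge (∑' n, c n ω ^ 2)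
  obtain ⟨l, hl⟩ := h1 K
  refine ⟨l, hl.congr fun n => sum_congr rfl fun k _ => ?_⟩
  have hmem : ω ∈ T K k := (h2.sum_le_tsum _ fun _ _ => sq_nonneg _).trans hK
  simp [d, g, hmem]

end Noise

/-! ### Nonexpansive building blocks -/

theorem abs_sup'_sub_sup'_le {α : Type*} {F : Finset α} (hF : F.Nonempty) {f g : α → ℝ} {c : ℝ}
    (h : ∀ a ∈ F, |f a - g a| ≤ c) : |F.sup' hF f - F.sup' hF g| ≤ c := by
  have key : ∀ {f g : α → ℝ}, (∀ a ∈ F, |f a - g a| ≤ c) → F.sup' hF f - F.sup' hF g ≤ c := by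
    intro f g h
    rw [sub_le_iff_le_add]
    refine sup'_le _ _ fun a ha => ?_
    linarith [(abs_le.1 (h a ha)).2, le_sup' g ha]
  have h1 := key h
  have h2 := key (f := g) (g := f) fun a ha => by rw [abs_sub_comm]; exact h a ha
  exact abs_le.2 ⟨by linarith, h1⟩

theorem abs_sum_mul_sub_sum_mul_le {α : Type*} [Fintype α] {p f g : α → ℝ} {c : ℝ}
    (hp : ∀ a, 0 ≤ p a) (hp1 : ∑ a, p a = 1) (h : ∀ a, |f a - g a| ≤ c) :
    |∑ a, p a * f a - ∑ a, p a * g a| ≤ c := by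
  rw [← sum_sub_distrib]
  calc _ ≤ ∑ a, p a * c := by
        refine (abs_sum_le_sum_abs _ _).trans (sum_le_sum fun a _ => ?_)
        rw [← mul_sub, abs_mul, abs_of_nonneg (hp a)]
        exact mul_le_mul_of_nonneg_left (h a) (hp a)
    _ = c := by rw [← sum_mul, hp1, one_mul]

/-- A function dominated by a discounted average of itself is nonpositive. -/
theorem nonpos_of_le_discounted_average {α : Type*} [Fintype α] {P : α → α → ℝ} {γ : ℝ}
    (hγ0 : 0 ≤ γ) (hγ1 : γ < 1) (hP : ∀ s s', 0 ≤ P s s') (hP1 : ∀ s, ∑ s', P s s' = 1)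
    {δ : α → ℝ} (h : ∀ s, δ s ≤ γ * ∑ s', P s s' * δ s') (s : α) : δ s ≤ 0 := by
  have : Nonempty α := ⟨s⟩
  -- Maximum principle: at a maximum point the hypothesis reads `δ m ≤ γ * δ m`.
  obtain ⟨m, hm⟩ := Finite.exists_max δ
  have h1 : ∑ s', P m s' * δ s' ≤ δ m := by
    calc _ ≤ ∑ s', P m s' * δ m :=
          sum_le_sum fun s' _ => mul_le_mul_of_nonneg_left (hm s') (hP m s')
      _ = δ m := by rw [← sum_mul, hP1, one_mul]
  have h2 := (h m).trans (mul_le_mul_of_nonneg_left h1 hγ0)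
  have h3 : δ m ≤ 0 := by nlinarith
  exact (hm s).trans h3

namespace WCMDP

variable {N L : ℕ} {X A : Fin N → Type*} {W : Type*}
  [∀ i, Fintype (X i)] [∀ i, Fintype (A i)] [Fintype W]
variable (M : WCMDP N L X A W)

/-! ### Policy values -/

theorem integral_nextLaw (s : State X W) (a : ∀ i, A i) (h : State X W → ℝ) :
    ∫ s', h s' ∂(M.nextLaw s a) = ∑ s', M.trans s a s' * h s' := by
  rw [nextLaw, integral_finsetSum_measure]
  · refine sum_congr rfl fun s' _ => ?_
    rw [integral_smul_measure, integral_dirac, ENNReal.toReal_ofReal (M.trans_nonneg _ _ _),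
      smul_eq_mul]
  · intro s' _
    exact (integrable_dirac (by simp)).smul_measure ENNReal.ofReal_ne_top

section PathLaw

variable (π : State X W → ∀ i, A i) (s : State X W) (a : ∀ i, A i)

instance : IsProbabilityMeasure (M.pathLaw π s a) :=
  inferInstanceAs (IsProbabilityMeasure (Kernel.traj _ _ _))

theorem integrable_pathLaw_comp (t : ℕ) (h : State X W → ℝ) :
    Integrable (fun ω => h (ω t)) (M.pathLaw π s a) := by
  obtain ⟨C, hC⟩ := Set.Finite.bddAbove (Set.finite_range fun s => |h s|)
  exact Integrable.of_bound
    (((measurable_of_countable h).comp (measurable_pi_apply t)).aestronglyMeasurable) C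
    (Eventually.of_forall fun ω => hC ⟨ω t, rfl⟩)

theorem integral_pathLaw_zero (h : State X W → ℝ) :
    ∫ ω, h (ω 0) ∂(M.pathLaw π s a) = h s := by
  have h1 : (M.pathLaw π s a).map (Preorder.frestrictLe 0) = Measure.dirac fun _ => s := by
    rw [pathLaw, Kernel.traj_map_frestrictLe_apply, Kernel.partialTraj_self, Kernel.id_apply]
  have h2 : Measurable fun x : (∀ _ : Iic 0, State X W) => h (x ⟨0, mem_Iic.2 le_rfl⟩) :=
    (measurable_of_countable h).comp (measurable_pi_apply _)
  have h3 := integral_map (μ := M.pathLaw π s a)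
    (Preorder.measurable_frestrictLe (X := fun _ => State X W) 0).aemeasurable
    h2.aestronglyMeasurable
  rw [h1, integral_dirac' _ _ h2.stronglyMeasurable] at h3
  exact h3.symm

/-- The Markov property: conditionally on the path up to `t`, the next state has law `stepKernel`.
-/
theorem integral_pathLaw_succ (t : ℕ) (h : State X W → ℝ) :
    ∫ ω, h (ω (t + 1)) ∂(M.pathLaw π s a)
      = ∫ ω, ∑ s', M.trans (ω t) (act π a t (ω t)) s' * h s' ∂(M.pathLaw π s a) := by
  have hh : Measurable h := measurable_of_countable h
  have h1 := Kernel.integral_traj_partialTraj (X := fun _ => State X W) (κ := M.stepKernel π a)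
    (x₀ := fun _ => s) (f := fun ω => h (ω (t + 1))) t.zero_le
    (M.integrable_pathLaw_comp π s a (t + 1) h)
  have h2 : ∀ x : (∀ _ : Iic t, State X W),
      ∫ y, h (y (t + 1)) ∂(Kernel.traj (X := fun _ => State X W) (M.stepKernel π a) t x)
        = ∑ s', M.trans (x ⟨t, mem_Iic.2 le_rfl⟩)
            (act π a t (x ⟨t, mem_Iic.2 le_rfl⟩)) s' * h s' := by
    intro x
    rw [← integral_nextLaw]
    have h3 : (Kernel.traj (X := fun _ => State X W) (M.stepKernel π a) t x).map
        (fun y => y (t + 1)) = M.stepKernel π a t x := by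
      rw [← Kernel.map_apply _ (measurable_pi_apply _), Kernel.map_traj_succ_self]
    change _ = ∫ s', h s' ∂(M.stepKernel π a t x)
    rw [← h3]
    exact (integral_map (φ := fun y : ℕ → State X W => y (t + 1))
      (measurable_pi_apply (t + 1)).aemeasurable hh.aestronglyMeasurable).symm
  have h4 : Measurable fun x : (∀ _ : Iic t, State X W) =>
      ∑ s', M.trans (x ⟨t, mem_Iic.2 le_rfl⟩) (act π a t (x ⟨t, mem_Iic.2 le_rfl⟩)) s' * h s' :=
    (measurable_of_countable fun s => ∑ s', M.trans s (act π a t s) s' * h s').comp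
      (measurable_pi_apply _)
  have h5 := integral_map (μ := M.pathLaw π s a)
    (Preorder.measurable_frestrictLe (X := fun _ => State X W) t).aemeasurable
    h4.aestronglyMeasurable
  rw [pathLaw, Kernel.traj_map_frestrictLe_apply] at h5
  simp_rw [h2] at h1
  exact h1.symm.trans h5

/-- From time `1` on the actions follow `π`, so the equation for `v` turns the expected discounted
rewards into a telescoping series with vanishing remainder. Only the reward at time `0` sees the
free action `a`. -/
theorem policyValue_eq {v : State X W → ℝ}
    (hv : ∀ s, v s = M.reward s (π s) + M.γ * ∑ s', M.trans s (π s) s' * v s') :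
    M.policyValue π s a = M.reward s a + M.γ * ∑ s', M.trans s a s' * v s' := by
  set P := M.pathLaw π s a with hP
  let F : ℕ → (ℕ → State X W) → ℝ := fun t ω => M.γ ^ t * M.reward (ω t) (act π a t (ω t))
  obtain ⟨C, hC⟩ : ∃ C, ∀ s a, |M.reward s a| ≤ C := by
    obtain ⟨C, hC⟩ := Set.Finite.bddAbove
      (Set.finite_range fun p : State X W × (∀ i, A i) => |M.reward p.1 p.2|)
    exact ⟨C, fun s a => hC ⟨(s, a), rfl⟩⟩
  obtain ⟨C', hC'⟩ : ∃ C, ∀ s, |v s| ≤ C := by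
    obtain ⟨C, hC⟩ := Set.Finite.bddAbove (Set.finite_range fun s => |v s|)
    exact ⟨C, fun s => hC ⟨s, rfl⟩⟩
  have hFi : ∀ t, Integrable (F t) P := fun t =>
    M.integrable_pathLaw_comp π s a t fun s => M.γ ^ t * M.reward s (act π a t s)
  have hsummable : Summable fun t => ∫ ω, ‖F t ω‖ ∂P := by
    refine Summable.of_nonneg_of_le (fun t => integral_nonneg fun ω => norm_nonneg _) (fun t => ?_)
      ((summable_geometric_of_lt_one M.γ_nonneg M.γ_lt_one).mul_right C)
    calc ∫ ω, ‖F t ω‖ ∂P ≤ ∫ _ω, M.γ ^ t * C ∂P := by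
          refine integral_mono (hFi t).norm (integrable_const _) fun ω => ?_
          simp only [F, norm_mul, Real.norm_eq_abs, abs_of_nonneg (pow_nonneg M.γ_nonneg t)]
          exact mul_le_mul_of_nonneg_left (hC _ _) (pow_nonneg M.γ_nonneg t)
      _ = M.γ ^ t * C := by simp
  have hsum : Tendsto (fun n => ∑ t ∈ range n, ∫ ω, F t ω ∂P) atTop (𝓝 (M.policyValue π s a)) :=
    (hasSum_integral_of_summable_integral_norm hFi hsummable).tendsto_sum_nat
  let I : ℕ → ℝ := fun t => ∫ ω, v (ω t) ∂P
  have hI1 : I 1 = ∑ s', M.trans s a s' * v s' := by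
    refine (M.integral_pathLaw_succ π s a 0 v).trans ?_
    exact M.integral_pathLaw_zero π s a fun s => ∑ s', M.trans s (act π a 0 s) s' * v s'
  have hF0 : ∫ ω, F 0 ω ∂P = M.reward s a := by
    refine (M.integral_pathLaw_zero π s a fun s => M.γ ^ 0 * M.reward s (act π a 0 s)).trans ?_
    simp [act]
  have hFs : ∀ t, ∫ ω, F (t + 1) ω ∂P = M.γ ^ (t + 1) * I (t + 1) - M.γ ^ (t + 2) * I (t + 2) := by
    intro t
    have h1 : I (t + 2) = _ := M.integral_pathLaw_succ π s a (t + 1) v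
    rw [h1, ← integral_const_mul, ← integral_const_mul, ← integral_sub]
    · refine integral_congr_ae (Eventually.of_forall fun ω => ?_)
      simp only [F, act, Nat.succ_ne_zero, if_false]
      rw [hv (ω (t + 1))]
      ring
    · exact (M.integrable_pathLaw_comp π s a (t + 1) v).const_mul _
    · exact (M.integrable_pathLaw_comp π s a (t + 1)
        fun s => ∑ s', M.trans s (act π a (t + 1) s) s' * v s').const_mul _
  have hpartial : ∀ n, ∑ t ∈ range (n + 1), ∫ ω, F t ω ∂P
      = M.reward s a + M.γ * I 1 - M.γ ^ (n + 1) * I (n + 1) := by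
    intro n
    induction n with
    | zero => simp [hF0]
    | succ n ih => rw [sum_range_succ, ih, hFs]; ring
  have hI0 : Tendsto (fun n => M.γ ^ n * I n) atTop (𝓝 0) := by
    have hIb : ∀ n, |I n| ≤ C' := fun n => by
      have := norm_integral_le_of_norm_le_const (μ := P) (f := fun ω => v (ω n)) (C := C')
        (Eventually.of_forall fun ω => hC' _)
      simpa using this
    refine squeeze_zero_norm (a := fun n => M.γ ^ n * C') (fun n => ?_) (by
      simpa using (tendsto_pow_atTop_nhds_zero_of_lt_one M.γ_nonneg M.γ_lt_one).mul_const C')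
    rw [norm_mul, Real.norm_eq_abs, Real.norm_eq_abs, abs_of_nonneg (pow_nonneg M.γ_nonneg n)]
    exact mul_le_mul_of_nonneg_left (hIb n) (pow_nonneg M.γ_nonneg n)
  have h1 := hsum.comp (tendsto_add_atTop_nat 1)
  have h2 : Tendsto (fun n => M.reward s a + M.γ * I 1 - M.γ ^ (n + 1) * I (n + 1)) atTop
      (𝓝 (M.reward s a + M.γ * I 1 - 0)) :=
    tendsto_const_nhds.sub (hI0.comp (tendsto_add_atTop_nat 1))
  rw [sub_zero, hI1] at h2
  exact tendsto_nhds_unique h1 (h2.congr fun n => (by rw [Function.comp_apply, hpartial, hI1]))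

end PathLaw

/-! ### The optimal action values -/

theorem nonexpansive_trans_sup :
    Nonexpansive fun (y : State X W × (∀ i, A i) → ℝ) (p : State X W × (∀ i, A i)) =>
      ∑ s', M.trans p.1 p.2 s' * (M.feasible s').sup' (M.feasible_nonempty s') fun a' => y (s', a') :=
  fun _ _ _ _ h p => abs_sum_mul_sub_sum_mul_le (M.trans_nonneg p.1 p.2) (M.trans_sum p.1 p.2)
    fun _ => abs_sup'_sub_sup'_le _ fun _ _ => h _

/-- The Bellman optimality equation. -/
theorem Qstar_eq (s : State X W) (a : ∀ i, A i) :
    M.Qstar s a = M.reward s a + M.γ *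
      ∑ s', M.trans s a s' * (M.feasible s').sup' (M.feasible_nonempty s') (M.Qstar s') := by
  -- The Bellman fixed point `Q` dominates every policy value, and a policy greedy for `Q` attains
  -- it, so it coincides with `Qstar`.
  obtain ⟨Q, hQ⟩ := (M.nonexpansive_trans_sup).exists_fixedPoint M.γ_nonneg M.γ_lt_one
    fun p => M.reward p.1 p.2
  set V : State X W → ℝ := fun s => (M.feasible s).sup' (M.feasible_nonempty s) fun a => Q (s, a)
    with hV
  have hQV : ∀ s a, Q (s, a) = M.reward s a + M.γ * ∑ s', M.trans s a s' * V s' :=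
    fun s a => hQ (s, a)
  have hle : ∀ (π : M.Policy) s a, M.policyValue π.1 s a ≤ Q (s, a) := by
    intro π s a
    have hnon : Nonexpansive fun (y : State X W → ℝ) s => ∑ s', M.trans s (π.1 s) s' * y s' :=
      fun _ _ _ _ h s => abs_sum_mul_sub_sum_mul_le (M.trans_nonneg s _) (M.trans_sum s _) h
    obtain ⟨v, hv⟩ := hnon.exists_fixedPoint M.γ_nonneg M.γ_lt_one fun s => M.reward s (π.1 s)
    have hvV : ∀ s, v s - V s ≤ 0 := by
      refine nonpos_of_le_discounted_average (P := fun s s' => M.trans s (π.1 s) s') M.γ_nonneg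
        M.γ_lt_one (fun s => M.trans_nonneg s _) (fun s => M.trans_sum s _) fun s => ?_
      have h1 : Q (s, π.1 s) ≤ V s := le_sup' (fun a => Q (s, a)) (π.2 s)
      rw [hQV] at h1
      simp only [mul_sub, sum_sub_distrib]
      linarith [hv s]
    rw [M.policyValue_eq π.1 s a hv, hQV]
    refine add_le_add_right (mul_le_mul_of_nonneg_left (sum_le_sum fun s' _ => ?_) M.γ_nonneg) _
    exact mul_le_mul_of_nonneg_left (sub_nonpos.1 (hvV s')) (M.trans_nonneg _ _ _)
  choose g hg hgV using fun s =>
    exists_mem_eq_sup' (M.feasible_nonempty s) fun a => Q (s, a)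
  have hgreedy : ∀ s a, M.policyValue g s a = Q (s, a) := by
    intro s a
    rw [M.policyValue_eq g s a (v := V), hQV]
    intro s
    rw [← hQV]
    exact hgV s
  have hstar : ∀ s a, M.Qstar s a = Q (s, a) := by
    intro s a
    have : Nonempty M.Policy := ⟨⟨g, hg⟩⟩
    refine le_antisymm (ciSup_le fun π => hle π s a) ?_
    rw [← hgreedy s a]
    exact le_ciSup (f := fun π : M.Policy => M.policyValue π.1 s a)
      ⟨Q (s, a), by rintro _ ⟨π, rfl⟩; exact hle π s a⟩ ⟨g, hg⟩
  have hstar' : ∀ s, M.Qstar s = fun a => Q (s, a) := fun s => funext (hstar s)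
  simp only [hstar']
  exact hQV s a

/-- Every supersolution of the Bellman optimality equation dominates the optimal action values. -/
theorem Qstar_le_of_supersolution {Q : State X W → (∀ i, A i) → ℝ}
    (hQ : ∀ s, ∀ a ∈ M.feasible s, M.reward s a + M.γ *
      ∑ s', M.trans s a s' * (M.feasible s').sup' (M.feasible_nonempty s') (Q s') ≤ Q s a)
    (s : State X W) (a : ∀ i, A i) (ha : a ∈ M.feasible s) : M.Qstar s a ≤ Q s a := by
  choose g hg hgV using fun s => exists_mem_eq_sup' (M.feasible_nonempty s) (M.Qstar s)
  have hV : ∀ s, (M.feasible s).sup' (M.feasible_nonempty s) (M.Qstar s)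
      - (M.feasible s).sup' (M.feasible_nonempty s) (Q s) ≤ 0 := by
    -- Along the policy `g` greedy for `Qstar`, the gap between the two state values is at most its
    -- own discounted average.
    refine nonpos_of_le_discounted_average (P := fun s s' => M.trans s (g s) s') M.γ_nonneg
      M.γ_lt_one (fun s => M.trans_nonneg s _) (fun s => M.trans_sum s _) fun s => ?_
    have h1 := hQ s (g s) (hg s)
    have h2 := le_sup' (Q s) (hg s)
    rw [hgV s, M.Qstar_eq]
    simp only [mul_sub, sum_sub_distrib]
    linarith
  rw [M.Qstar_eq]
  refine le_trans (add_le_add_right (mul_le_mul_of_nonneg_left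
    (sum_le_sum fun s' _ => ?_) M.γ_nonneg) _) (hQ s a ha)
  exact mul_le_mul_of_nonneg_left (sub_nonpos.1 (hV s')) (M.trans_nonneg _ _ _)

end WCMDP

/-! ### Measurability helpers -/

theorem measurable_finset_sup' {Ω α : Type*} {m : MeasurableSpace Ω} {F : Finset α}
    (hF : F.Nonempty) {f : α → Ω → ℝ} (hf : ∀ a ∈ F, Measurable (f a)) :
    Measurable fun ω => F.sup' hF fun a => f a ω := by
  simpa only [← Finset.sup'_apply] using Finset.measurable_sup' hF hf

theorem measurable_finset_inf' {Ω α : Type*} {m : MeasurableSpace Ω} {F : Finset α}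
    (hF : F.Nonempty) {f : α → Ω → ℝ} (hf : ∀ a ∈ F, Measurable (f a)) :
    Measurable fun ω => F.inf' hF fun a => f a ω := by
  induction hF using Finset.Nonempty.cons_induction with
  | singleton a => simpa using hf a (mem_singleton_self a)
  | cons a F ha hF ih =>
    simp only [inf'_cons hF]
    exact (hf a (mem_cons_self a F)).inf (ih fun b hb => hf b (mem_cons_of_mem hb))

theorem measurable_eval_finite {Ω S : Type*} {m : MeasurableSpace Ω} [Finite S] {ν : Ω → S}
    (hν : ∀ s, MeasurableSet {ω | ν ω = s}) {F : S → Ω → ℝ} (hF : ∀ s, Measurable (F s)) :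
    Measurable fun ω => F (ν ω) ω := by
  classical
  have := Fintype.ofFinite S
  have h : (fun ω => F (ν ω) ω) = fun ω => ∑ s, {ω | ν ω = s}.indicator (F s) ω := by
    ext ω
    rw [sum_eq_single (ν ω) (fun s _ hs => Set.indicator_of_notMem (fun h => hs h.symm) _)
      (by simp)]
    exact (Set.indicator_of_mem (s := {ω' | ν ω' = ν ω}) rfl _).symm
  rw [h]
  exact Finset.measurable_fun_sum _ fun s _ => (hF s).indicator (hν s)

namespace WCMDP

variable {N L : ℕ} {X A : Fin N → Type*} {W : Type*}
  [∀ i, Fintype (X i)] [∀ i, Fintype (A i)] [Fintype W]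
variable (M : WCMDP N L X A W)

/-! ### Marginals of the transition law -/

theorem sum_trans_mul_w (s : State X W) (a : ∀ i, A i) (y : W → ℝ) :
    ∑ s', M.trans s a s' * y s'.w = ∑ w', M.q s.w w' * y w' := by
  classical
  rw [← State.equivProd.symm.sum_comp, Fintype.sum_prod_type]
  simp only [trans, State.equivProd, Equiv.coe_fn_symm_mk, mul_assoc]
  simp_rw [← mul_sum]
  rw [← sum_mul, ← Fintype.piFinset_univ, ← prod_univ_sum]
  simp [M.p_sum]

theorem sum_trans_mul_sub (s : State X W) (a : ∀ i, A i) (i : Fin N) (y : X i × W → ℝ) :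
    ∑ s', M.trans s a s' * y (s'.sub i)
      = ∑ x', ∑ w', M.p i (s.x i) (a i) x' * M.q s.w w' * y (x', w') := by
  classical
  have key : ∀ f : X i → ℝ, ∑ x : ∀ j, X j, (∏ j, M.p j (s.x j) (a j) (x j)) * f (x i)
      = ∑ x', M.p i (s.x i) (a i) x' * f x' := by
    intro f
    let P : ∀ j, X j → ℝ := fun j => M.p j (s.x j) (a j)
    -- Absorbing `f` into the factor `i` keeps the summand a product, so the sum factorizes and the
    -- other factors sum to one.
    let P' : ∀ j, X j → ℝ := Function.update P i fun x' => P i x' * f x'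
    have h1 : ∀ x : ∀ j, X j, (∏ j, P j (x j)) * f (x i) = ∏ j, P' j (x j) := by
      intro x
      rw [Fintype.prod_eq_mul_prod_compl i, Fintype.prod_eq_mul_prod_compl i fun j => P' j (x j),
        mul_right_comm]
      congr 1
      · simp [P']
      · refine prod_congr rfl fun j hj => ?_
        have : j ≠ i := by simpa using hj
        simp [P', this]
    change ∑ x : ∀ j, X j, (∏ j, P j (x j)) * f (x i) = _
    simp_rw [h1]
    rw [← Fintype.piFinset_univ, ← prod_univ_sum, Fintype.prod_eq_mul_prod_compl i,
      prod_eq_one (s := {i}ᶜ), mul_one]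
    · simp [P', P]
    · intro j hj
      have : j ≠ i := by simpa using hj
      simp [P', P, this, M.p_sum]
  rw [← State.equivProd.symm.sum_comp, Fintype.sum_prod_type]
  simp only [trans, State.equivProd, Equiv.coe_fn_symm_mk, State.sub, mul_assoc]
  simp_rw [← mul_sum]
  exact key fun x' => ∑ w', M.q s.w w' * y (x', w')

/-! ### Lagrangian upper bounds -/

/-- The Lagrangian values built from the exact subproblem values and the exact discounted
right-hand sides dominate the optimal action values. -/
theorem Qstar_le_lagrangian [∀ i, Nonempty (A i)] {lam : Fin L → ℝ} (hlam : 0 ≤ lam)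
    {B : W → Fin L → ℝ} (hB : ∀ w l, B w l = M.b w l + M.γ * ∑ w', M.q w w' * B w' l)
    (s : State X W) (a : ∀ i, A i) (ha : a ∈ M.feasible s) :
    M.Qstar s a ≤ lam ⬝ᵥ B s.w + ∑ i, M.subQ lam i (s.sub i) (a i) := by
  refine M.Qstar_le_of_supersolution
    (Q := fun s a => lam ⬝ᵥ B s.w + ∑ i, M.subQ lam i (s.sub i) (a i)) (fun s a ha => ?_) s a ha
  -- Relaxation: without the linking constraints the maximum separates over subproblems.
  have hsup : ∀ s' : State X W, (M.feasible s').sup' (M.feasible_nonempty s')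
      (fun a => lam ⬝ᵥ B s'.w + ∑ i, M.subQ lam i (s'.sub i) (a i))
      ≤ lam ⬝ᵥ B s'.w + ∑ i, univ.sup' univ_nonempty (M.subQ lam i (s'.sub i)) := fun s' =>
    sup'_le _ _ fun a _ => add_le_add_right
      (sum_le_sum fun i _ => le_sup' (M.subQ lam i (s'.sub i)) (mem_univ (a i))) _
  have hBs : lam ⬝ᵥ B s.w = lam ⬝ᵥ M.b s.w + M.γ * ∑ s', M.trans s a s' * (lam ⬝ᵥ B s'.w) := by
    rw [M.sum_trans_mul_w s a fun w' => lam ⬝ᵥ B w']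
    simp only [dotProduct]
    simp_rw [mul_sum]
    rw [sum_comm, ← sum_add_distrib]
    refine sum_congr rfl fun l _ => ?_
    rw [hB, mul_add, mul_sum, mul_sum]
    congr 1
    exact sum_congr rfl fun w' _ => by ring
  have hsub : ∀ i, M.subQ lam i (s.sub i) (a i) = M.r i (s.sub i) (a i)
      - lam ⬝ᵥ M.d i (s.sub i) (a i)
      + M.γ * ∑ s', M.trans s a s' * univ.sup' univ_nonempty (M.subQ lam i (s'.sub i)) := by
    intro i
    rw [M.sum_trans_mul_sub s a i fun t => univ.sup' univ_nonempty (M.subQ lam i t)]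
    exact (congrFun (congrFun (M.subQ_eq lam i) (s.sub i)) (a i)).symm
  -- The only use of `lam ≥ 0` and of the feasibility of `a`.
  have hd : ∑ i, lam ⬝ᵥ M.d i (s.sub i) (a i) ≤ lam ⬝ᵥ M.b s.w := by
    rw [← dotProduct_sum]
    have ha' : ∑ i, M.d i (s.sub i) (a i) ≤ M.b s.w := by simpa [feasible] using ha
    exact dotProduct_le_dotProduct_of_nonneg_left ha' hlam
  calc _ ≤ M.reward s a + M.γ * ∑ s', M.trans s a s' *
        (lam ⬝ᵥ B s'.w + ∑ i, univ.sup' univ_nonempty (M.subQ lam i (s'.sub i))) :=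
      add_le_add_right (mul_le_mul_of_nonneg_left (sum_le_sum fun s' _ =>
        mul_le_mul_of_nonneg_left (hsup s') (M.trans_nonneg _ _ _)) M.γ_nonneg) _
    _ = M.reward s a + M.γ * ∑ s', M.trans s a s' * (lam ⬝ᵥ B s'.w)
        + ∑ i, M.γ * ∑ s', M.trans s a s' *
          univ.sup' univ_nonempty (M.subQ lam i (s'.sub i)) := by
      simp only [mul_add, sum_add_distrib]
      rw [add_assoc, ← mul_sum, sum_comm (s := univ (α := Fin N))]
      simp only [mul_sum]
    _ ≤ lam ⬝ᵥ B s.w + ∑ i, M.subQ lam i (s.sub i) (a i) := by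
      rw [hBs, sum_congr rfl fun i _ => hsub i]
      simp only [sum_add_distrib, sum_sub_distrib, reward]
      linarith

/-! ### Almost sure convergence of the common scheme -/

namespace Run

variable {M} {Ω : Type*}

theorem RobbinsMonro.eventually_le_one {u : ℕ → ℝ} (h : RobbinsMonro u) :
    ∀ᶠ n in atTop, u n ≤ 1 := by
  filter_upwards [h.2.tendsto_atTop_zero.eventually_lt_const one_pos] with n hn
  nlinarith

variable [mΩ : MeasurableSpace Ω] {μ : Measure Ω} [IsProbabilityMeasure μ] {ℱ : Filtration ℕ mΩ}
  {R : Run M Ω}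

/-- Almost sure convergence of an asynchronous, possibly projected, stochastic approximation driven
by the experience of a run. -/
theorem IsSampled.ae_tendsto (hR : R.IsSampled μ ℱ) {ι : Type*} [Finite ι]
    {a x u : ℕ → Ω → ι → ℝ} {V : (ι → ℝ) → State X W → ℝ} {E : (ι → ℝ) → ι → ℝ} {g xs : ι → ℝ}
    (hV : Nonexpansive V) (hE : Nonexpansive E) (hxs : ∀ e, xs e = g e + M.γ * E xs e)
    (ha0 : ∀ n ω e, 0 ≤ a n ω e) (ham : ∀ n e, Measurable[ℱ n] fun ω => a n ω e)
    (haRM : ∀ᵐ ω ∂μ, ∀ e, RobbinsMonro fun n => a n ω e)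
    (hxm : ∀ n e, Measurable[ℱ n] fun ω => x n ω e)
    (hupper : ∀ n ω e, x (n + 1) ω e
      ≤ x n ω e + a n ω e * (g e + M.γ * V (x n ω) (R.next n ω) - x n ω e))
    (hlower : ∀ n ω e, min (u (n + 1) ω e)
      (x n ω e + a n ω e * (g e + M.γ * V (x n ω) (R.next n ω) - x n ω e)) ≤ x (n + 1) ω e)
    (hu : ∀ᵐ ω ∂μ, ∀ e, ∀ δ > 0, ∀ᶠ n in atTop, xs e - δ ≤ u n ω e)
    (hEV : ∀ n ω e, a n ω e ≠ 0 → ∀ y,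
      ∑ s', M.trans (R.state n ω) (R.action n ω) s' * V y s' = E y e) :
    ∀ᵐ ω ∂μ, ∀ e, Tendsto (fun n => x n ω e) atTop (𝓝 (xs e)) := by
  have := Fintype.ofFinite ι
  -- The noise is split over the successor `s'`: the weight `c` is known at time `n`, and the
  -- randomness is the indicator `f` of `next = s'`, bounded by `1`.
  let c : ι → State X W → ℕ → Ω → ℝ := fun e s' n ω => a n ω e * (M.γ * V (x n ω) s')
  let f : State X W → ℕ → Ω → ℝ := fun s' n => {ω | R.next n ω = s'}.indicator fun _ => 1
  have hcm : ∀ e s' n, Measurable[ℱ n] (c e s' n) := fun e s' n =>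
    (ham n e).mul (((hV.measurable s').comp
      (@measurable_pi_lambda _ _ _ (ℱ n) _ _ (hxm n))).const_mul _)
  have hfm : ∀ s' n, Measurable[ℱ (n + 1)] (f s' n) := fun s' n =>
    Measurable.indicator (@measurable_const _ _ _ (ℱ (n + 1)) 1) (hR.next n s')
  have hf1 : ∀ s' n ω, |f s' n ω| ≤ 1 := by
    intro s' n ω
    by_cases h : R.next n ω = s' <;> simp [f, h]
  have hcsum : ∀ᵐ ω ∂μ, ∀ e s', Summable fun n => c e s' n ω ^ 2 := by
    filter_upwards [haRM, hu] with ω hω hu e s'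
    obtain ⟨K, hK⟩ := exists_abs_le_of_projected_iteration (ν := fun n => R.next n ω) M.γ_nonneg
      M.γ_lt_one hV (fun n => ha0 n ω) (fun e => (hω e).eventually_le_one)
      (fun n => hupper n ω) (fun n => hlower n ω) hu
    refine Summable.of_norm_bounded_eventually_nat
      (g := fun n => a n ω e ^ 2 * (M.γ * (|K| + |V xs s'|)) ^ 2) ((hω e).2.mul_right _) ?_
    filter_upwards [hK] with n hn
    have h1 := hV (x n ω) xs |K| (abs_nonneg K) (fun e => (hn e).trans (le_abs_self K)) s'
    have h2 : |V (x n ω) s'| ≤ |K| + |V xs s'| := by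
      have := abs_sub_abs_le_abs_sub (V (x n ω) s') (V xs s')
      linarith
    rw [Real.norm_eq_abs, abs_pow, abs_mul, mul_pow, sq_abs, abs_mul, abs_of_nonneg M.γ_nonneg]
    refine mul_le_mul_of_nonneg_left (pow_le_pow_left₀
      (mul_nonneg M.γ_nonneg (abs_nonneg _)) ?_ 2) (sq_nonneg _)
    exact mul_le_mul_of_nonneg_left h2 M.γ_nonneg
  have hnoise : ∀ᵐ ω ∂μ, ∀ e s', ∃ l, Tendsto (fun n => ∑ k ∈ range n,
      c e s' k ω * (f s' k ω - (μ[f s' k | ℱ k]) ω)) atTop (𝓝 l) := by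
    refine ae_all_iff.2 fun e => ae_all_iff.2 fun s' =>
      ae_exists_tendsto_sum_mul_sub_condExp (hcm e s') (hfm s') (hf1 s') ?_
    filter_upwards [hcsum] with ω hω using hω e s'
  have hlaw : ∀ᵐ ω ∂μ, ∀ n s',
      (μ[f s' n | ℱ n]) ω = M.trans (R.state n ω) (R.action n ω) s' :=
    ae_all_iff.2 fun n => ae_all_iff.2 fun s' => hR.next_law n s'
  filter_upwards [haRM, hu, hnoise, hlaw] with ω hω hu hnoise hlaw
  refine tendsto_of_projected_iteration (ν := fun n => R.next n ω) M.γ_nonneg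
    M.γ_lt_one hV hE hxs (fun n => ha0 n ω) (fun e => (hω e).eventually_le_one)
    (fun e => (hω e).1) (fun n => hupper n ω) (fun n => hlower n ω) hu fun e => ?_
  choose l hl using hnoise e
  refine ⟨∑ s', l s', (tendsto_finsetSum univ fun s' _ => hl s').congr fun n => ?_⟩
  rw [sum_comm]
  refine sum_congr rfl fun k _ => ?_
  -- The sampled transition has mean `E` only for entries being updated; for the others the noise
  -- term vanishes with the step size.
  by_cases h0 : a k ω e = 0
  · simp [c, h0]
  · rw [← hEV k ω e h0]
    have h1 : ∑ s', V (x k ω) s' * f s' k ω = V (x k ω) (R.next k ω) := by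
      rw [sum_eq_single (R.next k ω)]
      · simp [f]
      · intro s' _ hs'
        simp [f, hs'.symm]
      · simp
    rw [← h1, ← sum_sub_distrib, mul_sum, mul_sum]
    refine sum_congr rfl fun s' _ => ?_
    rw [hlaw]
    simp only [c]
    ring

end Run

end WCMDP

/-! ### The restriction to feasible pairs and the three tables -/

namespace WCMDP

variable {N L : ℕ} {X A : Fin N → Type*} {W : Type*}
  [∀ i, Fintype (X i)] [∀ i, Fintype (A i)] [Fintype W]
variable (M : WCMDP N L X A W)

/-- The entries of the main agent's table that correspond to feasible actions. -/
abbrev FeasiblePair : Type _ := {p : State X W × (∀ i, A i) // p.2 ∈ M.feasible p.1}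

open Classical in
/-- The greedy value of a table of feasible pairs. -/
def greedyValue (y : M.FeasiblePair → ℝ) (s : State X W) : ℝ :=
  (M.feasible s).sup' (M.feasible_nonempty s)
    -- The default `0` is never read, as the supremum runs over feasible actions.
    fun a => if h : a ∈ M.feasible s then y ⟨(s, a), h⟩ else 0

theorem greedyValue_restrict (Q : State X W → (∀ i, A i) → ℝ) (s : State X W) :
    M.greedyValue (fun e => Q e.1.1 e.1.2) s
      = (M.feasible s).sup' (M.feasible_nonempty s) (Q s) :=
  sup'_congr _ rfl fun a ha => by simp [ha]

theorem nonexpansive_greedyValue : Nonexpansive M.greedyValue :=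
  fun _ _ _ _ h s => abs_sup'_sub_sup'_le _ fun a ha => by simpa [ha] using h ⟨(s, a), ha⟩

namespace Run

variable {M} {Ω : Type*} [mΩ : MeasurableSpace Ω] {μ : Measure Ω} {ℱ : Filtration ℕ mΩ}
  {R : Run M Ω}

/-! ### The tables are adapted -/

theorem IsSampled.measurable_B (hR : R.IsSampled μ ℱ) (n : ℕ) (w : W) (l : Fin L) :
    Measurable[ℱ n] fun ω => R.B ω n w l := by
  induction n generalizing w with
  | zero => exact hR.initB w l
  | succ n ih =>
    have hle := ℱ.mono n.le_succ
    have h1 : Measurable[ℱ (n + 1)] fun ω => R.B ω n (R.next n ω).w l :=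
      measurable_eval_finite (F := fun s ω => R.B ω n s.w l) (hR.next n)
        fun s => (ih s.w).mono hle le_rfl
    have h2 := (ih w).mono hle le_rfl
    exact h2.add (((hR.η n w).mono hle le_rfl).mul (((h1.const_mul M.γ).const_add _).sub h2))

/-- Each coordinate `l` is a scalar policy evaluation on the exogenous chain. With no projection,
the limit itself serves as `u`. -/
theorem IsSampled.ae_tendsto_B [IsProbabilityMeasure μ] (hR : R.IsSampled μ ℱ) (hs : R.StepSizes μ) {B : W → Fin L → ℝ}
    (hB : ∀ w l, B w l = M.b w l + M.γ * ∑ w', M.q w w' * B w' l) :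
    ∀ᵐ ω ∂μ, ∀ w l, Tendsto (fun n => R.B ω n w l) atTop (𝓝 (B w l)) := by
  have h : ∀ l, ∀ᵐ ω ∂μ, ∀ w, Tendsto (fun n => R.B ω n w l) atTop (𝓝 (B w l)) := by
    intro l
    have hstep : ∀ n ω w, R.B ω (n + 1) w l = R.B ω n w l + R.η n ω w *
        (M.b w l + M.γ * R.B ω n (R.next n ω).w l - R.B ω n w l) := fun _ _ _ => rfl
    refine hR.ae_tendsto (x := fun n ω w => R.B ω n w l) (xs := fun w => B w l)
      (u := fun _ _ w => B w l)
      (V := fun y s => y s.w) (E := fun y w => ∑ w', M.q w w' * y w') (g := fun w => M.b w l)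
      (fun _ _ _ _ h s => h s.w)
      (fun _ _ _ _ h w => abs_sum_mul_sub_sum_mul_le (M.q_nonneg w) (M.q_sum w) h)
      (fun w => hB w l) hs.η_nonneg hR.η hs.η_sum (fun n w => hR.measurable_B n w l)
      (fun n ω w => (hstep n ω w).le) (fun n ω w => (min_le_right _ _).trans (hstep n ω w).ge)
      (Eventually.of_forall fun ω w δ hδ => Eventually.of_forall fun n => by linarith) ?_
    intro n ω w hne y
    have hw : (R.state n ω).w = w := not_not.1 fun h => hne (hs.η_async n ω w h)
    rw [M.sum_trans_mul_w, hw]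
  filter_upwards [ae_all_iff.2 h] with ω hω w l using hω l w

variable [∀ i, Nonempty (A i)]

theorem IsSampled.measurable_sub (hR : R.IsSampled μ ℱ) (lam : Fin L → ℝ) (n : ℕ) (i : Fin N)
    (s : X i × W) (a : A i) : Measurable[ℱ n] fun ω => R.sub lam ω n i s a := by
  induction n generalizing s a with
  | zero => exact hR.initSub lam i s a
  | succ n ih =>
    have hle := ℱ.mono n.le_succ
    have h1 : Measurable[ℱ (n + 1)] fun ω =>
        univ.sup' univ_nonempty (R.sub lam ω n i ((R.next n ω).sub i)) :=
      measurable_eval_finite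
        (F := fun s ω => univ.sup' univ_nonempty (R.sub lam ω n i (s.sub i))) (hR.next n)
        fun s => measurable_finset_sup' _ fun a _ => (ih (s.sub i) a).mono hle le_rfl
    have h2 := (ih s a).mono hle le_rfl
    exact h2.add (((hR.β n i s a).mono hle le_rfl).mul
      (((h1.const_mul M.γ).const_add _).sub h2))

theorem IsSampled.measurable_lagMin (hR : R.IsSampled μ ℱ) (Lam : Finset (Fin L → ℝ))
    (hLam : Lam.Nonempty) (n : ℕ) (s : State X W) (a : ∀ i, A i) :
    Measurable[ℱ n] fun ω => R.lagMin Lam hLam ω n s a :=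
  measurable_finset_inf' _ fun lam _ =>
    (Finset.measurable_fun_sum _ fun l _ => (hR.measurable_B n s.w l).const_mul (lam l)).add
      (Finset.measurable_fun_sum _ fun i _ => hR.measurable_sub lam n i (s.sub i) (a i))

theorem IsSampled.measurable_wcql (hR : R.IsSampled μ ℱ) (Lam : Finset (Fin L → ℝ))
    (hLam : Lam.Nonempty) (n : ℕ) (s : State X W) (a : ∀ i, A i) :
    Measurable[ℱ n] fun ω => R.wcql Lam hLam ω n s a := by
  induction n generalizing s a with
  | zero => exact hR.initQ s a
  | succ n ih =>
    have hle := ℱ.mono n.le_succ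
    have h1 : Measurable[ℱ (n + 1)] fun ω => (M.feasible (R.next n ω)).sup'
        (M.feasible_nonempty _) (R.wcql Lam hLam ω n (R.next n ω)) :=
      measurable_eval_finite (F := fun s ω =>
          (M.feasible s).sup' (M.feasible_nonempty _) (R.wcql Lam hLam ω n s)) (hR.next n)
        fun s => measurable_finset_sup' _ fun a _ => (ih s a).mono hle le_rfl
    have h2 := (ih s a).mono hle le_rfl
    exact (hR.measurable_lagMin Lam hLam (n + 1) s a).min
      (h2.add (((hR.α n s a).mono hle le_rfl).mul (((h1.const_mul M.γ).const_add _).sub h2)))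

/-! ### Convergence of the tables -/

variable [IsProbabilityMeasure μ]

theorem IsSampled.ae_tendsto_sub (hR : R.IsSampled μ ℱ) (hs : R.StepSizes μ) (lam : Fin L → ℝ)
    (i : Fin N) :
    ∀ᵐ ω ∂μ, ∀ s a, Tendsto (fun n => R.sub lam ω n i s a) atTop (𝓝 (M.subQ lam i s a)) := by
  have h := hR.ae_tendsto (ι := (X i × W) × A i)
    (x := fun n ω e => R.sub lam ω n i e.1 e.2) (xs := fun e => M.subQ lam i e.1 e.2)
    (u := fun _ _ e => M.subQ lam i e.1 e.2) (a := fun n ω e => R.β n ω i e.1 e.2)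
    (V := fun y s => univ.sup' univ_nonempty fun a => y (s.sub i, a))
    (E := fun y e => ∑ p : X i × W, M.p i e.1.1 e.2 p.1 * M.q e.1.2 p.2 *
      univ.sup' univ_nonempty fun a => y (p, a))
    (g := fun e => M.r i e.1 e.2 - lam ⬝ᵥ M.d i e.1 e.2)
    (fun _ _ _ _ h s => abs_sup'_sub_sup'_le _ fun a _ => h _)
    (fun _ _ _ _ h e => abs_sum_mul_sub_sum_mul_le
      (fun p => mul_nonneg (M.p_nonneg _ _ _ _) (M.q_nonneg _ _))
      (by
        rw [Fintype.sum_prod_type]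
        simp_rw [← mul_sum, M.q_sum, mul_one, M.p_sum])
      fun p => abs_sup'_sub_sup'_le _ fun a _ => h _)
    (fun e => by
      rw [Fintype.sum_prod_type]
      exact (congrFun (congrFun (M.subQ_eq lam i) e.1) e.2).symm)
    (fun n ω e => hs.β_nonneg n ω i e.1 e.2) (fun n e => hR.β n i e.1 e.2)
    (by filter_upwards [hs.β_sum] with ω hω e using hω i e.1 e.2)
    (fun n e => hR.measurable_sub lam n i e.1 e.2) (fun n ω e => le_rfl)
    (fun n ω e => min_le_right _ _)
    (Eventually.of_forall fun ω w δ hδ => Eventually.of_forall fun n => by linarith)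
    (by
      intro n ω e hne y
      have hv : (R.state n ω).sub i = e.1 ∧ R.action n ω i = e.2 :=
        not_not.1 fun h => hne (hs.β_async n ω i e.1 e.2 h)
      rw [M.sum_trans_mul_sub _ _ i fun p => univ.sup' univ_nonempty fun a => y (p, a),
        Fintype.sum_prod_type, ← hv.1, ← hv.2]
      rfl)
  filter_upwards [h] with ω hω s a using hω (s, a)

/-- Finitely many multipliers, each with a limit above `Qstar`, put `lagMin` eventually above `Qstar
- δ`, which is all the projected scheme asks of `u`. -/
theorem IsSampled.ae_tendsto_wcql (hR : R.IsSampled μ ℱ) (hs : R.StepSizes μ)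
    (Lam : Finset (Fin L → ℝ)) (hLam : Lam.Nonempty)
    (hlag : ∀ᵐ ω ∂μ, ∀ lam ∈ Lam, ∀ s, ∀ a ∈ M.feasible s, ∃ l,
      Tendsto (fun n => R.lag lam ω n s a) atTop (𝓝 l) ∧ M.Qstar s a ≤ l) :
    ∀ᵐ ω ∂μ, ∀ s, ∀ a ∈ M.feasible s,
      Tendsto (fun n => R.wcql Lam hLam ω n s a) atTop (𝓝 (M.Qstar s a)) := by
  -- Targets maximize over feasible actions only, so the feasible entries form a closed system.
  -- Infeasible ones have to be left out: for them neither divergent step sums nor the Lagrangian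
  -- bound is available.
  have hstep : ∀ n ω (e : M.FeasiblePair), R.wcql Lam hLam ω (n + 1) e.1.1 e.1.2
      = min (R.lagMin Lam hLam ω (n + 1) e.1.1 e.1.2) (R.wcql Lam hLam ω n e.1.1 e.1.2
        + R.α n ω e.1.1 e.1.2 * (M.reward e.1.1 e.1.2
          + M.γ * M.greedyValue (fun e => R.wcql Lam hLam ω n e.1.1 e.1.2) (R.next n ω)
          - R.wcql Lam hLam ω n e.1.1 e.1.2)) := by
    intro n ω e
    rw [M.greedyValue_restrict]
    rfl
  have h := hR.ae_tendsto (ι := M.FeasiblePair)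
    (x := fun n ω e => R.wcql Lam hLam ω n e.1.1 e.1.2) (xs := fun e => M.Qstar e.1.1 e.1.2)
    (u := fun n ω e => R.lagMin Lam hLam ω n e.1.1 e.1.2)
    (a := fun n ω e => R.α n ω e.1.1 e.1.2) (V := M.greedyValue)
    (E := fun y e => ∑ s', M.trans e.1.1 e.1.2 s' * M.greedyValue y s')
    (g := fun e => M.reward e.1.1 e.1.2) M.nonexpansive_greedyValue
    (fun x y c hc h e => abs_sum_mul_sub_sum_mul_le (M.trans_nonneg _ _) (M.trans_sum _ _)
      (M.nonexpansive_greedyValue x y c hc h))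
    (fun e => by
      simp only [M.greedyValue_restrict]
      exact M.Qstar_eq _ _)
    (fun n ω e => hs.α_nonneg n ω _ _) (fun n e => hR.α n _ _)
    (by filter_upwards [hs.α_sum] with ω hω e using hω e.1.1 e.1.2 e.2)
    (fun n e => hR.measurable_wcql Lam hLam n _ _)
    (fun n ω e => (hstep n ω e).trans_le (min_le_right _ _))
    (fun n ω e => (hstep n ω e).ge)
    (by
      filter_upwards [hlag] with ω hω e δ hδ
      simp only [lagMin, le_inf'_iff]
      refine (eventually_all_finset Lam).2 fun lam hlam => ?_
      obtain ⟨l, hl, hle⟩ := hω lam hlam e.1.1 e.1.2 e.2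
      filter_upwards [hl.eventually_const_lt (show M.Qstar e.1.1 e.1.2 - δ < l by linarith)]
        with n hn using hn.le)
    (by
      intro n ω e hne y
      have hv : R.state n ω = e.1.1 ∧ R.action n ω = e.1.2 :=
        not_not.1 fun h => hne (hs.α_async n ω _ _ h)
      rw [hv.1, hv.2])
  filter_upwards [h] with ω hω s a ha using hω ⟨(s, a), ha⟩

end Run

end WCMDP

end WeaklyCoupled

end

/-! ### Assembly of the convergence theorem -/

theorem theorem1 {N L : ℕ} {X A : Fin N → Type*} {W : Type*}
    [∀ i, Fintype (X i)] [∀ i, Fintype (A i)] [∀ i, Nonempty (A i)] [Fintype W]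
    (M : WeaklyCoupled.WCMDP N L X A W)
    (Lam : Finset (Fin L → ℝ)) (hLam : Lam.Nonempty) (hLam_nonneg : ∀ lam ∈ Lam, 0 ≤ lam)
    {Ω : Type*} [mΩ : MeasurableSpace Ω] (μ : MeasureTheory.Measure Ω)
    [MeasureTheory.IsProbabilityMeasure μ] (ℱ : MeasureTheory.Filtration ℕ mΩ)
    (R : M.Run Ω) (hsampled : R.IsSampled μ ℱ) (hstep : R.StepSizes μ)
    (hvisit : R.VisitsAll μ) :
    ∀ᵐ ω ∂μ,
      (∀ i, ∀ lam ∈ Lam, ∀ s a,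
        Tendsto (fun n => R.sub lam ω n i s a) atTop (𝓝 (M.subQ lam i s a))) ∧
      (∀ lam ∈ Lam, ∀ s a, ∃ l : ℝ,
        Tendsto (fun n => R.lag lam ω n s a) atTop (𝓝 l) ∧
          (a ∈ M.feasible s → M.Qstar s a ≤ l)) ∧
      (∀ s, ∀ a ∈ M.feasible s,
        Tendsto (fun n => R.wcql Lam hLam ω n s a) atTop (𝓝 (M.Qstar s a))) := by
  have hexists : ∀ l, ∃ y : W → ℝ, ∀ w, y w = M.b w l + M.γ * ∑ w', M.q w w' * y w' := fun l =>
    WeaklyCoupled.Nonexpansive.exists_fixedPoint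
      (E := fun (y : W → ℝ) w => ∑ w', M.q w w' * y w')
      (fun _ _ _ _ h w => WeaklyCoupled.abs_sum_mul_sub_sum_mul_le (M.q_nonneg w) (M.q_sum w) h)
      M.γ_nonneg M.γ_lt_one fun w => M.b w l
  -- `y l` is the exact expected discounted sum of the right-hand side of constraint `l`, the limit
  -- of that coordinate of `B`.
  choose y hy using hexists
  have hB := hsampled.ae_tendsto_B hstep (B := fun w l => y l w) fun w l => hy l w
  have hsub : ∀ᵐ ω ∂μ, ∀ lam ∈ Lam, ∀ i s a,
      Tendsto (fun n => R.sub lam ω n i s a) atTop (𝓝 (M.subQ lam i s a)) :=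
    (eventually_all_finset Lam).2 fun lam _ =>
      ae_all_iff.2 fun i => hsampled.ae_tendsto_sub hstep lam i
  have hlag : ∀ᵐ ω ∂μ, ∀ lam ∈ Lam, ∀ s a, ∃ l : ℝ,
      Tendsto (fun n => R.lag lam ω n s a) atTop (𝓝 l) ∧
        (a ∈ M.feasible s → M.Qstar s a ≤ l) := by
    filter_upwards [hB, hsub] with ω hB hsub lam hlam s a
    refine ⟨lam ⬝ᵥ (fun l => y l s.w) + ∑ i, M.subQ lam i (s.sub i) (a i), ?_, fun ha => ?_⟩
    · exact (tendsto_finsetSum _ fun l _ => (hB s.w l).const_mul (lam l)).add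
        (tendsto_finsetSum _ fun i _ => hsub lam hlam i (s.sub i) (a i))
    · exact M.Qstar_le_lagrangian (hLam_nonneg lam hlam) (B := fun w l => y l w)
        (fun w l => hy l w) s a ha
  have hwcql := hsampled.ae_tendsto_wcql hstep Lam hLam (by
    filter_upwards [hlag] with ω hω lam hlam s a ha
    obtain ⟨l, hl, hle⟩ := hω lam hlam s a
    exact ⟨l, hl, hle ha⟩)
  filter_upwards [hsub, hlag, hwcql] with ω h1 h2 h3
  exact ⟨fun i lam hlam => h1 lam hlam i, h2, h3⟩
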